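/- Let $\mathbb{C}_+=\{s:\operatorname{Re}s>0\}$ and $\mathbb{R}_-=(-\infty,0]$. A function $f$ on $\mathbb{C}\setminus\mathbb{R}_-$ is a Stieltjes function if $f(\lambda)=\int_{\mathbb{R}_-}\frac{d\mu(z)}{\lambda-z}$ for all $\lambda\in\mathbb{C}\setminus\mathbb{R}_-$, for some probability measure $\mu$ on $\mathbb{R}_-$. A function $h$ on $\mathbb{C}_+$ is passive if (i) it is analytic in $\mathbb{C}_+$ (no poles); (ii) $h(\bar s)=\overline{h(s)}$ for $s\in\mathbb{C}_+$; (iii) $\operatorname{Re}h(i\omega+0)\ge 0$, in the sense that $\omega\mapsto\operatorname{Re}h(\varepsilon+i\omega)$ converges, as $\varepsilon\downarrow0$, in the sense of distributions on $\mathbb{R}$, to a nonnegative distribution. A passive $h$ is a passive transfer function if moreover it has the growth and the normalization of a transfer function: there is a constant $C$ with $|h(s)|\le C/\operatorname{Re}s$ for all $s\in\mathbb{C}_+$, and $x\,h(x)\to1$ as $x\to+\infty$ along the real axis. A first-order system consists of complex Hilbert spaces $H,K$, a closed densely defined operator $L$ from $K$ to $H$, a bounded operator $\sigma\ge0$ on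 $H$, and $g\in H$ with $\|g\|=1$; its transfer function is $h(s)=\langle g,\tilde u\rangle$, $s\in\mathbb{C}_+$, where $\tilde u\in\operatorname{dom}L^*$ and $v\in\operatorname{dom}L$ solve $(s+\sigma)\tilde u+Lv=g$, $sv-L^*\tilde u=0$. It is lossless if $\sigma=0$ and lossy otherwise. Consider the correspondence $f(\lambda)=\lambda^{-1/2}h(\lambda^{1/2})$, $\lambda\in\mathbb{C}\setminus\mathbb{R}_-$, with the principal branch. Then: (1) for every Stieltjes function $f$ there is exactly one function $h$ on $\mathbb{C}_+$ that corresponds to it, and $h$ is a passive transfer function; (2) for every passive transfer function $h$, the one function $f$ on $\mathbb{C}\setminus\mathbb{R}_-$ that corresponds to it is a Stieltjes function; (3) every first-order system, lossy or lossless, has a well-defined transfer function $h$ on $\mathbb{C}_+$, which is a passive transfer function; and there is a lossless first-order system that has the same transfer function. If $h$ is in pole–residue form $h(s)=\sum_{j=1}^n\Big(\frac{y_j}{s+\lambda_j}+\frac{\bar y_j}{s+\bar\lambda_j}\Big)$ with $y_j\in\mathbb{C}$ and $\operatorname{Re}\lambda_j>0$, then the lossless system can be chosen such that $LL^*$ has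 no eigenvalues. Hence pole–residue data cannot distinguish a lossy system with discrete complex poles (as arises for a lossy bounded medium) from a lossless system without point spectrum (as arises for a lossless medium on a semi-infinite domain). -/

import Mathlib

open scoped ContDiff ComplexConjugate Topology
open Filter MeasureTheory

/-- The open right half-plane `ℂ₊`. -/
def rightHalfPlane : Set ℂ := {s | 0 < s.re}

/-- `f` is a Stieltjes function: `f lam = ∫_{(-∞, 0]} dμ(z) / (lam - z)` on `ℂ ∖ (-∞, 0]`
(which is `Complex.slitPlane`), for a probability measure `μ` on `(-∞, 0]`. The density `ρ` of
the classical notation is the distributional derivative of `μ`, that is `ρ(z) dz = dμ(z)`. -/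
def IsStieltjes (f : ℂ → ℂ) : Prop :=
  ∃ μ : Measure ℝ, IsProbabilityMeasure μ ∧ μ (Set.Ioi 0) = 0 ∧
    ∀ lam ∈ Complex.slitPlane, f lam = ∫ z : ℝ, 1 / (lam - (z : ℂ)) ∂μ

/-- The correspondence `f(lam) = lam^{-1/2} h(lam^{1/2})` on `ℂ ∖ (-∞, 0]`, with the principal
branch, so that `lam^{1/2}` runs through `ℂ₊`. -/
def Corresponds (f h : ℂ → ℂ) : Prop :=
  ∀ lam ∈ Complex.slitPlane, f lam = lam ^ (-(1 / 2) : ℂ) * h (lam ^ (1 / 2 : ℂ))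

/-- `Re h(i t + 0) ≥ 0` for real `t`: as `ε ↓ 0`, the function `t ↦ Re h(ε + i t)` converges,
in the sense of distributions on `ℝ`, to a nonnegative distribution. -/
def HasNonnegBoundaryRe (h : ℂ → ℂ) : Prop :=
  ∀ φ : ℝ → ℝ, ContDiff ℝ ∞ φ → HasCompactSupport φ → (∀ t, 0 ≤ φ t) →
    ∃ l : ℝ, 0 ≤ l ∧
      Tendsto (fun ε : ℝ => ∫ t : ℝ, (h ((ε : ℂ) + Complex.I * (t : ℂ))).re * φ t)
        (𝓝[>] 0) (𝓝 l)

/-- The three criteria of passivity for a single-input single-output system. -/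
structure IsPassive (h : ℂ → ℂ) : Prop where
  /-- `h` is analytic in `ℂ₊`: it has no poles there. -/
  analytic : DifferentiableOn ℂ h rightHalfPlane
  /-- `h(s̄)` is the complex conjugate of `h(s)`. -/
  conj_symm : ∀ s ∈ rightHalfPlane, h (conj s) = conj (h s)
  /-- The real part is nonnegative on the imaginary axis. -/
  boundary : HasNonnegBoundaryRe h

/-- The growth and the normalization of a transfer function `h(s) = g^* (s + B)⁻¹ g`, with `B`
dissipative and `g` a unit vector: `h(s) = O(1 / Re s)` in `ℂ₊`, and `s h(s) → 1` as
`s → +∞` along the real axis. -/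
structure HasTransferGrowth (h : ℂ → ℂ) : Prop where
  bound : ∃ C : ℝ, ∀ s ∈ rightHalfPlane, ‖h s‖ ≤ C / s.re
  normalized : Tendsto (fun x : ℝ => (x : ℂ) * h (x : ℂ)) atTop (𝓝 1)

/-- Passive transfer functions. -/
structure IsPassiveTransfer (h : ℂ → ℂ) : Prop where
  passive : IsPassive h
  growth : HasTransferGrowth h

/-- The data of a first-order system on Hilbert spaces: a closed densely defined operator `L`
from `K` to `H`, a loss term `σ ≥ 0`, and a source `g` of norm one. -/
structure FirstOrderSystem (H K : Type*)
    [NormedAddCommGroup H] [InnerProductSpace ℂ H]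
    [NormedAddCommGroup K] [InnerProductSpace ℂ K] where
  L : K →ₗ.[ℂ] H
  dense_domain : Dense (L.domain : Set K)
  closed : L.IsClosed
  loss : H →L[ℂ] H
  loss_nonneg : loss.IsPositive
  source : H
  norm_source : ‖source‖ = 1

namespace FirstOrderSystem

variable {H K : Type*} [NormedAddCommGroup H] [InnerProductSpace ℂ H]
  [NormedAddCommGroup K] [InnerProductSpace ℂ K] [CompleteSpace K]

/-- `(u, v)` solves the system at the frequency `s`:
`(s + σ) u + L v = g` and `s v - L^* u = 0`. -/
def Solves (S : FirstOrderSystem H K) (s : ℂ)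
    (u : S.L.adjoint.domain) (v : S.L.domain) : Prop :=
  s • (u : H) + S.loss (u : H) + S.L v = S.source ∧ s • (v : K) - S.L.adjoint u = 0

/-- `h` is the transfer function of the system on `ℂ₊`: the system is solvable for every
`s` in `ℂ₊`, and `h(s) = g^* u` for its solutions `(u, v)`. -/
def IsTransferFunction (S : FirstOrderSystem H K) (h : ℂ → ℂ) : Prop :=
  ∀ s ∈ rightHalfPlane,
    (∃ (u : S.L.adjoint.domain) (v : S.L.domain), S.Solves s u v) ∧
    ∀ (u : S.L.adjoint.domain) (v : S.L.domain), S.Solves s u v →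
      h s = inner ℂ S.source (u : H)

/-- The system is lossless: `σ = 0`. -/
def IsLossless (S : FirstOrderSystem H K) : Prop := S.loss = 0

/-- The operator `A = L L^*` of the system has no point spectrum (no eigenvalue). -/
def NoPointSpectrum (S : FirstOrderSystem H K) : Prop :=
  ∀ (κ : ℂ) (u : S.L.adjoint.domain) (v : S.L.domain),
    (v : K) = S.L.adjoint u → S.L v = κ • (u : H) → (u : H) = 0

end FirstOrderSystem

/-- `h` is in pole–residue form on `ℂ₊`, with `n` complex-conjugate pairs of poles
`-p j`, `-conj (p j)`, all in the open left half-plane, and residues `y j`, `conj (y j)`. -/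
def HasPoleResidueForm (h : ℂ → ℂ) : Prop :=
  ∃ (n : ℕ) (y p : Fin n → ℂ), (∀ j, 0 < (p j).re) ∧
    ∀ s ∈ rightHalfPlane, h s = ∑ j, (y j / (s + p j) + conj (y j) / (s + conj (p j)))

/-! Everything passes through one integral representation. A holomorphic `h` on the right half-plane
with `Re h ≥ 0`, real symmetry and `x h(x) → 1` is `∫ dκ(t) / (s + it)` for a probability measure
`κ`, and the symmetry turns this into `∫ s / (s² + t²) dκ(t)`. Under `z = -t²` and `λ = s²` this is
exactly `s f(s²)` with `f` Stieltjes.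

The representation (`exists_probabilityMeasure_cauchyTransform`) is the Herglotz formula on the
disc, carried over by the Cayley transform. The normalization at infinity excludes a linear term `b
s` and fixes the total mass.

For an abstract passive `h`, positivity is known only on the boundary, as a distribution. Averaging
`h` vertically against a test function gives a function whose derivatives are averages of the same
kind, so the bound `C / Re s` can be integrated twice, to a logarithmic bound and then to a
constant. The average therefore extends continuously to the imaginary axis, Phragmén–Lindelöf gives
it nonnegative real part, and shrinking the test function gives `Re h ≥ 0`
(`re_nonneg_of_hasNonnegBoundaryRe`). Conversely, the real part of `1 / (s + it)` is a Poisson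
kernel, so a Cauchy transform has nonnegative boundary values.

For a first-order system, Lax–Milgram gives solvability, and an energy inequality gives uniqueness,
bounds and `Re h ≥ 0` directly. The same representation applies, and multiplication by `t` on
`L²(κ)` with source `1` is a lossless system with the same `h`. A pole–residue `h` is bounded on the
half-plane, hence `κ` has no atoms and multiplication by `t²` has no eigenvalues. -/

/-! ### The Herglotz representation on the disc -/

open Metric Real in
/-- The Herglotz–Riesz formula for a function holomorphic on a neighbourhood of the disc. -/
theorem eq_circleAverage_herglotzRieszKernel_re {F : ℂ → ℂ} {R : ℝ} (hR : 1 < R)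
    (hF : DifferentiableOn ℂ F (ball 0 R)) {w : ℂ} (hw : w ∈ ball (0 : ℂ) 1) :
    F w = circleAverage (fun ζ ↦ herglotzRieszKernel 0 w ζ • ((F ζ).re : ℂ)) 0 1
      + (F 0).im * Complex.I := by
  have hsub : closedBall (0 : ℂ) 1 ⊆ ball 0 R := closedBall_subset_ball hR
  have hcl : DiffContOnCl ℂ F (ball 0 1) :=
    ⟨hF.mono (ball_subset_closedBall.trans hsub), by
      rw [closure_ball _ one_ne_zero]; exact hF.continuousOn.mono hsub⟩
  have hcont : ContinuousOn F (sphere 0 1) :=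
    hF.continuousOn.mono (sphere_subset_closedBall.trans hsub)
  have hgi : CircleIntegrable (fun ζ ↦ (F ζ).re) 0 1 :=
    (Complex.continuous_re.comp_continuousOn hcont).circleIntegrable zero_le_one
  have hgi' : CircleIntegrable (fun ζ ↦ ((F ζ).re : ℂ)) 0 1 :=
    (Complex.continuous_ofReal.comp_continuousOn
      (Complex.continuous_re.comp_continuousOn hcont)).circleIntegrable zero_le_one
  set G : ℂ → ℂ := fun w ↦ circleAverage (fun ζ ↦ herglotzRieszKernel 0 w ζ • ((F ζ).re : ℂ)) 0 1
    with hG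
  have hGan : AnalyticOnNhd ℂ G (ball 0 1) :=
    analyticOnNhd_circleAverage_herglotzRieszKernel_smul hgi'
  have hFan : AnalyticOnNhd ℂ F (ball 0 1) := hcl.1.analyticOnNhd isOpen_ball
  -- The real part of the kernel is the Poisson kernel, so `F` and `G` have equal real parts and
  -- differ by a constant, which is evaluated at `0`.
  have hre : ∀ z ∈ ball (0 : ℂ) 1, (F z).re = (G z).re := by
    intro z hz
    rw [hG, re_circleAverage_herglotzRieszKernel_smul hgi hz]
    conv_lhs => rw [← hcl.circleAverage_re_herglotzRieszKernel_smul hz]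
    have hi : CircleIntegrable ((Complex.re ∘ herglotzRieszKernel 0 z) • F) 0 1 := by
      apply ContinuousOn.circleIntegrable zero_le_one
      refine ContinuousOn.smul (Complex.continuous_re.comp_continuousOn ?_) hcont
      simpa using continuousOn_herglotzRieszKernel_sphere hz
    have := Complex.reCLM.circleAverage_comp_comm hi
    simp only [Complex.reCLM_apply] at this
    rw [← this]
    congr 1
    ext ζ
    simp
  obtain ⟨c, hc⟩ := (hFan.sub hGan).eq_const_of_re_eq_const (c₀ := 0)
    (fun z hz ↦ by simp [hre z hz]) isOpen_ball ((convex_ball _ _).isConnected ⟨0, mem_ball_self one_pos⟩)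
  have h0 : G 0 = ((F 0).re : ℂ) := by
    have : G 0 = circleAverage (fun ζ ↦ ((F ζ).re : ℂ)) 0 1 := by
      refine circleAverage_congr_sphere fun ζ hζ ↦ ?_
      have : ζ ≠ 0 := by rintro rfl; simp at hζ
      simp [herglotzRieszKernel_def, this]
    have h1 := Complex.ofRealCLM.circleAverage_comp_comm hgi
    have h2 := Complex.reCLM.circleAverage_comp_comm (hcont.circleIntegrable zero_le_one)
    have h3 : circleAverage F 0 1 = F 0 := by
      have := hcl.circleAverage_re_herglotzRieszKernel_smul (mem_ball_self one_pos)
      rw [← this]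
      refine circleAverage_congr_sphere fun ζ hζ ↦ ?_
      have : ζ ≠ 0 := by rintro rfl; simp at hζ
      simp [herglotzRieszKernel_def, this]
    rw [this]
    rw [h3] at h2
    simp only [Complex.reCLM_apply] at h2
    rw [← h2]
    exact h1
  have h00 := hc 0 (mem_ball_self one_pos)
  have hw' := hc w hw
  simp only [Pi.sub_apply, h0] at h00 hw'
  have : (F 0) - ((F 0).re : ℂ) = (F 0).im * Complex.I := by
    apply Complex.ext <;> simp
  rw [this] at h00
  rw [h00, ← hw']
  ring

theorem continuous_herglotzRieszKernel_circleMap {w : ℂ} (hw : w ∈ Metric.ball (0 : ℂ) 1) :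
    Continuous fun θ : ℝ ↦ herglotzRieszKernel 0 w (circleMap 0 1 θ) := by
  have := (continuousOn_herglotzRieszKernel_sphere hw).comp_continuous
    (continuous_circleMap 0 1) (fun θ ↦ by simp)
  exact this

theorem norm_herglotzRieszKernel_circleMap_le {w : ℂ} (hw : w ∈ Metric.ball (0 : ℂ) 1) (θ : ℝ) :
    ‖herglotzRieszKernel 0 w (circleMap 0 1 θ)‖ ≤ 2 / (1 - ‖w‖) := by
  have hw1 : ‖w‖ < 1 := by simpa using hw
  have hc : ‖circleMap 0 1 θ‖ = 1 := by simp
  rw [herglotzRieszKernel_def, norm_div]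
  simp only [sub_zero]
  have h1 : ‖circleMap 0 1 θ + w‖ ≤ 2 := (norm_add_le _ _).trans (by rw [hc]; linarith)
  have h2 : 1 - ‖w‖ ≤ ‖circleMap 0 1 θ - w‖ := by
    have := norm_sub_norm_le (circleMap 0 1 θ) w
    rwa [hc] at this
  have h3 : 0 < 1 - ‖w‖ := by linarith
  gcongr

open Metric Real in
/-- The **Herglotz representation** of a holomorphic function of nonnegative real part on the
unit disc. -/
theorem exists_measure_herglotz {F : ℂ → ℂ} (hF : DifferentiableOn ℂ F (ball 0 1))
    (hre : ∀ w ∈ ball (0 : ℂ) 1, 0 ≤ (F w).re) :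
    ∃ ν : Measure ℝ, IsFiniteMeasure ν ∧ ∀ w ∈ ball (0 : ℂ) 1,
      F w = ∫ θ, herglotzRieszKernel 0 w (circleMap 0 1 θ) ∂ν + (F 0).im * Complex.I := by
  -- the approximating densities
  let d : ℝ → ℝ → ℝ := fun r θ ↦ (2 * π)⁻¹ * (F (r * circleMap 0 1 θ)).re
  have hmem : ∀ r ∈ Set.Ioo (0 : ℝ) 1, ∀ z : ℂ, ‖z‖ < r⁻¹ → (r : ℂ) * z ∈ ball (0 : ℂ) 1 := by
    intro r hr z hz
    have : r * ‖z‖ < 1 := by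
      calc r * ‖z‖ < r * r⁻¹ := by gcongr; exact hr.1
        _ = 1 := mul_inv_cancel₀ hr.1.ne'
    simpa [abs_of_pos hr.1] using this
  have hmem1 : ∀ r ∈ Set.Ioo (0 : ℝ) 1, ∀ θ : ℝ, (r : ℂ) * circleMap 0 1 θ ∈ ball (0 : ℂ) 1 :=
    fun r hr θ ↦ hmem r hr _ (by simpa using (one_lt_inv₀ hr.1).2 hr.2)
  have hd0 : ∀ r ∈ Set.Ioo (0 : ℝ) 1, ∀ θ, 0 ≤ d r θ := fun r hr θ ↦
    mul_nonneg (by positivity) (hre _ (hmem1 r hr θ))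
  have hdc : ∀ r ∈ Set.Ioo (0 : ℝ) 1, Continuous (d r) := by
    intro r hr
    refine continuous_const.mul (Complex.continuous_re.comp ?_)
    exact hF.continuousOn.comp_continuous
      (continuous_const.mul (continuous_circleMap 0 1)) (hmem1 r hr)
  let m : ℝ → Measure ℝ := fun r ↦
    (volume.restrict (Set.Ioc 0 (2 * π))).withDensity fun θ ↦ ENNReal.ofReal (d r θ)
  have hint : ∀ r ∈ Set.Ioo (0 : ℝ) 1, ∀ g : ℝ → ℂ, ∫ θ, g θ ∂(m r) =
      (2 * π)⁻¹ * ∫ θ in (0 : ℝ)..(2 * π), g θ * ((F (r * circleMap 0 1 θ)).re : ℂ) := by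
    intro r hr g
    have h1 := integral_withDensity_eq_integral_toReal_smul
      (μ := volume.restrict (Set.Ioc 0 (2 * π))) (f := fun θ ↦ ENNReal.ofReal (d r θ))
      ((hdc r hr).measurable.ennreal_ofReal) (by simp) g
    rw [h1, intervalIntegral.integral_of_le (by positivity), ← integral_const_mul]
    congr 1
    ext θ
    rw [ENNReal.toReal_ofReal (hd0 r hr θ)]
    simp only [d, Complex.real_smul]
    push_cast
    ring
  have hfin : ∀ r ∈ Set.Ioo (0 : ℝ) 1, IsFiniteMeasure (m r) := by
    intro r hr
    refine isFiniteMeasure_withDensity_ofReal ?_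
    exact ((hdc r hr).integrableOn_Icc.mono_set Set.Ioc_subset_Icc_self).2
  have hrep : ∀ r ∈ Set.Ioo (0 : ℝ) 1, ∀ w ∈ ball (0 : ℂ) 1, F (r * w) =
      ∫ θ, herglotzRieszKernel 0 w (circleMap 0 1 θ) ∂(m r) + (F 0).im * Complex.I := by
    intro r hr w hw
    have hd : DifferentiableOn ℂ (fun z : ℂ ↦ F (r * z)) (ball 0 r⁻¹) :=
      hF.comp (by fun_prop) fun z hz ↦ hmem r hr z (by simpa using hz)
    have := eq_circleAverage_herglotzRieszKernel_re ((one_lt_inv₀ hr.1).2 hr.2) hd hw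
    simp only [mul_zero] at this
    rw [this, hint r hr, circleAverage_def]
    simp [Complex.real_smul]
  have hmass : ∀ r ∈ Set.Ioo (0 : ℝ) 1, (m r).real Set.univ = (F 0).re := by
    intro r hr
    have := hfin r hr
    have h := hrep r hr 0 (mem_ball_self one_pos)
    have hk : ∀ θ : ℝ, herglotzRieszKernel 0 0 (circleMap 0 1 θ) = 1 := fun θ ↦ by
      simp [herglotzRieszKernel_def]
    simp only [hk, mul_zero, integral_const] at h
    have := congrArg Complex.re h
    simpa using this.symm
  let M : ℝ → FiniteMeasure ℝ := fun r ↦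
    if h : r ∈ Set.Ioo (0 : ℝ) 1 then ⟨m r, hfin r h⟩ else 0
  -- All approximating measures live on `[0, 2π]` with mass `Re F(0)`, hence in a weakly compact
  -- set. A limit along an ultrafilter finer than `r ↑ 1` replaces the extraction of a subsequence.
  have hcpt := isCompact_setOfPred_finiteMeasure_le_of_isCompact (E := ℝ) (F 0).re.toNNReal
    (isCompact_Icc (a := (0 : ℝ)) (b := 2 * π))
  have hev : ∀ᶠ r : ℝ in 𝓝[<] 1, r ∈ Set.Ioo (0 : ℝ) 1 := Ioo_mem_nhdsLT one_pos
  let U : Ultrafilter ℝ := Ultrafilter.of (𝓝[<] 1)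
  have hU : (U : Filter ℝ) ≤ 𝓝[<] 1 := Ultrafilter.of_le _
  have hM : ∀ᶠ r in (U : Filter ℝ), M r ∈
      {μ : FiniteMeasure ℝ | μ.mass ≤ (F 0).re.toNNReal ∧ μ (Set.Icc 0 (2 * π))ᶜ = 0} := by
    filter_upwards [hU hev] with r hr
    have := hfin r hr
    have hMr : M r = ⟨m r, hfin r hr⟩ := dif_pos hr
    rw [hMr]
    constructor
    · rw [← NNReal.coe_le_coe, Real.coe_toNNReal _ (hre 0 (mem_ball_self one_pos))]
      exact (hmass r hr).le
    · have : m r (Set.Icc 0 (2 * π))ᶜ = 0 := by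
        refine withDensity_absolutelyContinuous _ _ ?_
        rw [Measure.restrict_apply measurableSet_Icc.compl]
        convert measure_empty (μ := volume) using 2
        ext x
        simp only [Set.mem_inter_iff, Set.mem_compl_iff, Set.mem_Icc, Set.mem_Ioc]
        grind
      rw [FiniteMeasure.mk_apply, this]; rfl
  obtain ⟨ν, -, hν⟩ := isCompact_iff_ultrafilter_le_nhds'.1 hcpt (U.map M) hM
  refine ⟨ν, inferInstance, fun w hw ↦ ?_⟩
  have hlim : Tendsto M U (𝓝 ν) := hν
  let g : BoundedContinuousFunction ℝ ℂ := BoundedContinuousFunction.ofNormedAddCommGroup _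
    (continuous_herglotzRieszKernel_circleMap hw) _ (norm_herglotzRieszKernel_circleMap_le hw)
  have h1 := ((FiniteMeasure.tendsto_iff_forall_integral_rclike_tendsto ℂ).1 hlim g).add_const
    ((F 0).im * Complex.I)
  have h2 : Tendsto (fun r : ℝ ↦ F (r * w)) U (𝓝 (F w)) := by
    have hc : ContinuousAt F ((1 : ℝ) * w) := by
      rw [Complex.ofReal_one, one_mul]
      exact (hF.differentiableAt (isOpen_ball.mem_nhds hw)).continuousAt
    have h3 : Tendsto (fun r : ℝ ↦ (r : ℂ) * w) (𝓝 1) (𝓝 ((1 : ℝ) * w)) :=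
      Continuous.tendsto (by fun_prop) _
    have := hc.tendsto.comp (h3.mono_left (hU.trans nhdsWithin_le_nhds))
    simpa [Function.comp_def] using this
  refine tendsto_nhds_unique h2 (h1.congr' ?_)
  filter_upwards [hU hev] with r hr
  rw [hrep r hr w hw]
  have hMr : M r = ⟨m r, hfin r hr⟩ := dif_pos hr
  rw [hMr]
  rfl

/-! ### Cauchy transforms of measures on the imaginary axis -/

theorem isOpen_rightHalfPlane : IsOpen rightHalfPlane :=
  isOpen_lt continuous_const Complex.continuous_re

theorem ofReal_mem_rightHalfPlane {x : ℝ} (hx : 0 < x) : (x : ℂ) ∈ rightHalfPlane := by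
  simpa [rightHalfPlane] using hx

theorem conj_mem_rightHalfPlane {s : ℂ} (hs : s ∈ rightHalfPlane) : conj s ∈ rightHalfPlane := by
  simpa [rightHalfPlane] using hs

theorem re_le_norm_add_ofReal_mul_I (s : ℂ) (t : ℝ) : s.re ≤ ‖s + t * Complex.I‖ := by
  have := Complex.re_le_norm (s + t * Complex.I)
  simpa using this

theorem add_ofReal_mul_I_ne_zero {s : ℂ} (hs : s ∈ rightHalfPlane) (t : ℝ) :
    s + t * Complex.I ≠ 0 :=
  norm_pos_iff.1 (lt_of_lt_of_le hs (re_le_norm_add_ofReal_mul_I s t))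

theorem norm_one_div_add_ofReal_mul_I_le {s : ℂ} (hs : s ∈ rightHalfPlane) (t : ℝ) :
    ‖1 / (s + t * Complex.I)‖ ≤ 1 / s.re := by
  have hs' : 0 < s.re := hs
  rw [norm_div, norm_one]
  exact one_div_le_one_div_of_le hs' (re_le_norm_add_ofReal_mul_I s t)

theorem continuous_one_div_add_ofReal_mul_I {s : ℂ} (hs : s ∈ rightHalfPlane) :
    Continuous fun t : ℝ ↦ 1 / (s + t * Complex.I) :=
  continuous_const.div (by fun_prop) (add_ofReal_mul_I_ne_zero hs)

theorem integrable_one_div_add_ofReal_mul_I {κ : Measure ℝ} [IsFiniteMeasure κ] {s : ℂ}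
    (hs : s ∈ rightHalfPlane) : Integrable (fun t : ℝ ↦ 1 / (s + t * Complex.I)) κ :=
  .of_bound (continuous_one_div_add_ofReal_mul_I hs).aestronglyMeasurable _
    (.of_forall (norm_one_div_add_ofReal_mul_I_le hs))

/-- Dominated convergence, since `|x / (x + it)| ≤ 1`. The total mass is thus read off from the
behaviour at `+∞`. -/
theorem tendsto_mul_integral_one_div_add_ofReal_mul_I (κ : Measure ℝ) [IsFiniteMeasure κ] :
    Tendsto (fun x : ℝ ↦ (x : ℂ) * ∫ t : ℝ, 1 / ((x : ℂ) + t * Complex.I) ∂κ) atTop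
      (𝓝 (κ.real Set.univ)) := by
  have h1 : (κ.real Set.univ : ℂ) = ∫ _ : ℝ, (1 : ℂ) ∂κ := by simp
  simp_rw [h1, ← integral_const_mul]
  refine tendsto_integral_filter_of_dominated_convergence (fun _ ↦ 1) ?_ ?_ (by simp) ?_
  · filter_upwards [eventually_gt_atTop 0] with x hx
    exact (continuous_const.mul (continuous_one_div_add_ofReal_mul_I
      (ofReal_mem_rightHalfPlane hx))).aestronglyMeasurable
  · filter_upwards [eventually_gt_atTop 0] with x hx
    refine .of_forall fun t ↦ ?_
    have := norm_one_div_add_ofReal_mul_I_le (ofReal_mem_rightHalfPlane hx) t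
    rw [norm_mul, Complex.norm_real, Real.norm_of_nonneg hx.le]
    calc x * _ ≤ x * (1 / x) := by gcongr; simpa using this
      _ = 1 := by field_simp
  · refine .of_forall fun t ↦ ?_
    have h2 : Tendsto (fun x : ℝ ↦ 1 / (1 + t * Complex.I * ((x⁻¹ : ℝ) : ℂ))) atTop
        (𝓝 (1 / (1 + t * Complex.I * ((0 : ℝ) : ℂ)))) := by
      refine Tendsto.div tendsto_const_nhds ?_ (by simp)
      exact ((Complex.continuous_ofReal.tendsto 0).comp tendsto_inv_atTop_zero).const_mul _
        |>.const_add _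
    simp only [Complex.ofReal_zero, mul_zero, add_zero, div_one] at h2
    refine h2.congr' ?_
    filter_upwards [eventually_gt_atTop 0] with x hx
    have hx' : (x : ℂ) ≠ 0 := by exact_mod_cast hx.ne'
    have h3 := add_ofReal_mul_I_ne_zero (ofReal_mem_rightHalfPlane hx) t
    have h4 : 1 + t * Complex.I * ((x⁻¹ : ℝ) : ℂ) = (x + t * Complex.I) / x := by
      push_cast; field_simp
    rw [h4, one_div_div]
    ring

/-- The half-plane form of the Herglotz kernel, in terms of the half angle. -/
theorem herglotzRieszKernel_cayley {s : ℂ} (hs : s ∈ rightHalfPlane) (θ : ℝ) :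
    herglotzRieszKernel 0 ((1 - s) / (1 + s)) (circleMap 0 1 θ) =
      (Real.cos (θ / 2) + Complex.I * s * Real.sin (θ / 2)) /
        (s * Real.cos (θ / 2) + Complex.I * Real.sin (θ / 2)) := by
  have hs' : 0 < s.re := hs
  have h1s : 1 + s ≠ 0 := by
    intro h
    have := congrArg Complex.re h
    simp at this
    linarith
  set c := Real.cos (θ / 2) with hc
  set n := Real.sin (θ / 2) with hn
  have hcn : c ^ 2 + n ^ 2 = 1 := by rw [hc, hn, Real.cos_sq_add_sin_sq]
  have hcn' : (c : ℂ) ^ 2 + (n : ℂ) ^ 2 = 1 := by exact_mod_cast hcn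
  have he : circleMap 0 1 θ = ((c : ℂ) + n * Complex.I) ^ 2 := by
    rw [hc, hn, Complex.ofReal_cos, Complex.ofReal_sin, ← Complex.exp_mul_I, ← Complex.exp_nat_mul]
    simp only [circleMap, Complex.ofReal_one, zero_add, one_mul]
    congr 1
    push_cast
    ring
  have hē : ((c : ℂ) + n * Complex.I) * ((c : ℂ) - n * Complex.I) = 1 := by
    linear_combination hcn' - (n : ℂ) ^ 2 * Complex.I_sq
  have hē0 : (c : ℂ) - n * Complex.I ≠ 0 := right_ne_zero_of_mul_eq_one hē
  have hden : s * c + Complex.I * n ≠ 0 := by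
    intro h
    have h1 := congrArg Complex.re h
    have h2 := congrArg Complex.im h
    simp at h1 h2
    rcases h1 with h1 | h1
    · linarith
    · rw [h1] at h2 hcn
      simp at h2
      rw [h2] at hcn
      norm_num at hcn
  rw [herglotzRieszKernel_def, he]
  simp only [sub_zero]
  set e := (c : ℂ) + n * Complex.I
  set e' := (c : ℂ) - n * Complex.I
  have hnum : e ^ 2 + (1 - s) / (1 + s) =
      (2 / (e' * (1 + s))) * (c + Complex.I * s * n) := by
    field_simp
    have h1 : e ^ 2 * e' = e := by linear_combination e * hē
    simp only [e, e'] at h1 ⊢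
    linear_combination (1 + s) * h1
  have hd : e ^ 2 - (1 - s) / (1 + s) = (2 / (e' * (1 + s))) * (s * c + Complex.I * n) := by
    field_simp
    have h1 : e ^ 2 * e' = e := by linear_combination e * hē
    simp only [e, e'] at h1 ⊢
    linear_combination (1 + s) * h1
  rw [hnum, hd, mul_div_mul_left]
  exact div_ne_zero two_ne_zero (mul_ne_zero hē0 h1s)

theorem cayley_mem_ball {s : ℂ} (hs : s ∈ rightHalfPlane) :
    (1 - s) / (1 + s) ∈ Metric.ball (0 : ℂ) 1 := by
  have hs' : 0 < s.re := hs
  have h1s : 1 + s ≠ 0 := by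
    intro h
    have := congrArg Complex.re h
    simp at this
    linarith
  rw [mem_ball_zero_iff, norm_div, div_lt_one (norm_pos_iff.2 h1s)]
  rw [← sq_lt_sq₀ (norm_nonneg _) (norm_nonneg _), Complex.sq_norm, Complex.sq_norm,
    Complex.normSq_apply, Complex.normSq_apply]
  simp
  nlinarith

theorem cayley_mem_rightHalfPlane {w : ℂ} (hw : w ∈ Metric.ball (0 : ℂ) 1) :
    1 + w ≠ 0 ∧ (1 - w) / (1 + w) ∈ rightHalfPlane := by
  have hw1 : ‖w‖ < 1 := by simpa using hw
  have h1 : 1 + w ≠ 0 := by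
    intro h
    have : w = -1 := by linear_combination h
    rw [this] at hw1
    simp at hw1
  refine ⟨h1, ?_⟩
  have h2 : w.re ^ 2 + w.im ^ 2 < 1 := by
    have := Complex.sq_norm w
    rw [Complex.normSq_apply] at this
    nlinarith [norm_nonneg w]
  change 0 < ((1 - w) / (1 + w)).re
  rw [Complex.div_re, ← add_div]
  refine div_pos ?_ (Complex.normSq_pos.2 h1)
  simp
  nlinarith

/-- A holomorphic function on the half-plane with nonnegative real part and the normalization
`x h(x) → 1` is the Cauchy transform of a probability measure on the imaginary axis. -/
theorem exists_probabilityMeasure_cauchyTransform {h : ℂ → ℂ}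
    (hd : DifferentiableOn ℂ h rightHalfPlane) (hre : ∀ s ∈ rightHalfPlane, 0 ≤ (h s).re)
    (hn : Tendsto (fun x : ℝ ↦ (x : ℂ) * h (x : ℂ)) atTop (𝓝 1)) :
    ∃ κ : Measure ℝ, IsProbabilityMeasure κ ∧
      ∀ s ∈ rightHalfPlane, h s = ∫ t : ℝ, 1 / (s + t * Complex.I) ∂κ := by
  obtain ⟨ν, hν, hrep⟩ := exists_measure_herglotz (F := fun w ↦ h ((1 - w) / (1 + w)))
    (hd.comp (DifferentiableOn.div (by fun_prop) (by fun_prop)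
      fun w hw ↦ (cayley_mem_rightHalfPlane hw).1) fun w hw ↦ (cayley_mem_rightHalfPlane hw).2)
    (fun w hw ↦ hre _ (cayley_mem_rightHalfPlane hw).2)
  let c : ℝ → ℝ := fun θ ↦ Real.cos (θ / 2)
  let n : ℝ → ℝ := fun θ ↦ Real.sin (θ / 2)
  have hcn : ∀ θ, c θ ^ 2 + n θ ^ 2 = 1 := fun θ ↦ Real.cos_sq_add_sin_sq _
  have hcc : Continuous c := by fun_prop
  have hnc : Continuous n := by fun_prop
  let k : ℂ → ℝ → ℂ := fun s θ ↦ (c θ + Complex.I * s * n θ) / (s * c θ + Complex.I * n θ)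
  have hk : ∀ s ∈ rightHalfPlane, h s = ∫ θ, k s θ ∂ν + (h 1).im * Complex.I := by
    intro s hs
    have hs' : 0 < s.re := hs
    have h1s : 1 + s ≠ 0 := by
      intro h
      have := congrArg Complex.re h
      simp at this
      linarith
    have := hrep _ (cayley_mem_ball hs)
    have e1 : (1 - (1 - s) / (1 + s)) / (1 + (1 - s) / (1 + s)) = s := by
      have : (1 + (1 - s) / (1 + s)) = 2 / (1 + s) := by field_simp; ring
      rw [this]
      field_simp
      ring
    simp only [e1, herglotzRieszKernel_cayley hs] at this
    rw [show ((1 : ℂ) - 0) / (1 + 0) = 1 by norm_num] at this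
    exact this
  have hki : ∀ s ∈ rightHalfPlane, Integrable (k s) ν := by
    intro s hs
    have hb := cayley_mem_ball hs
    have : k s = fun θ ↦ herglotzRieszKernel 0 ((1 - s) / (1 + s)) (circleMap 0 1 θ) :=
      funext fun θ ↦ (herglotzRieszKernel_cayley hs θ).symm
    rw [this]
    exact .of_bound (continuous_herglotzRieszKernel_circleMap hb).aestronglyMeasurable _
      (.of_forall (norm_herglotzRieszKernel_circleMap_le hb))
  -- the real part along the positive axis
  have hkre : ∀ x : ℝ, 0 < x → ∀ θ, x * (k x θ).re = (c θ ^ 2 + n θ ^ 2 * (x⁻¹) ^ 2)⁻¹ := by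
    intro x hx θ
    have h0 : 0 < (x * c θ) ^ 2 + n θ ^ 2 := by
      have := hcn θ
      rcases eq_or_ne (n θ) 0 with h | h
      · have : c θ ≠ 0 := by rintro h'; rw [h, h'] at this; norm_num at this
        positivity
      · positivity
    have : (k x θ).re = x / ((x * c θ) ^ 2 + n θ ^ 2) := by
      simp only [k]
      rw [Complex.div_re, ← add_div, Complex.normSq_apply]
      simp
      congr 1
      · linear_combination x * hcn θ
      · ring
    rw [this]
    have h1 : c θ ^ 2 + n θ ^ 2 * (x⁻¹) ^ 2 = ((x * c θ) ^ 2 + n θ ^ 2) / x ^ 2 := by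
      field_simp
    rw [h1, inv_div]
    ring
  have hxint : ∀ x : ℝ, 0 < x →
      ∫⁻ θ, (ENNReal.ofReal (c θ ^ 2 + n θ ^ 2 * (x⁻¹) ^ 2))⁻¹ ∂ν =
        ENNReal.ofReal ((x : ℂ) * h x).re := by
    intro x hx
    have hx' := ofReal_mem_rightHalfPlane hx
    have h1 : ((x : ℂ) * h x).re = ∫ θ, x * (k x θ).re ∂ν := by
      rw [integral_const_mul]
      have := integral_re (hki _ hx')
      simp only [RCLike.re_to_complex] at this
      rw [this, hk _ hx']
      simp
    have h2 : ∀ θ, 0 < c θ ^ 2 + n θ ^ 2 * (x⁻¹) ^ 2 := by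
      intro θ
      have := hcn θ
      rcases eq_or_ne (n θ) 0 with h | h
      · have : c θ ≠ 0 := by rintro h'; rw [h, h'] at this; norm_num at this
        positivity
      · positivity
    rw [h1, ofReal_integral_eq_lintegral_ofReal]
    · refine lintegral_congr fun θ ↦ ?_
      rw [hkre x hx, ENNReal.ofReal_inv_of_pos (h2 θ)]
    · exact ((hki _ hx').re).const_mul x
    · refine .of_forall fun θ ↦ ?_
      change 0 ≤ x * (k x θ).re
      rw [hkre x hx]
      exact (inv_pos.2 (h2 θ)).le
  -- `D = 1 / cos²(θ/2)` is the density that turns `ν` into the measure on the line, with `t =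
  -- tan(θ/2)`. It is infinite where the circle point is `-1`, which corresponds to `s = ∞`.
  let D : ℝ → ENNReal := fun θ ↦ (ENNReal.ofReal (c θ ^ 2))⁻¹
  have hDm : Measurable D := by
    have : Measurable fun θ ↦ c θ ^ 2 := (hcc.pow 2).measurable
    exact this.ennreal_ofReal.inv
  -- Fatou along integers `x → ∞`: by `hxint` the approximating integrals are `Re (x h(x))`, which
  -- tends to `1`. In particular `ν` has no mass at `-1`, and so no term linear in `s` survives.
  have hD : ∫⁻ θ, D θ ∂ν ≤ 1 := by
    have hpt : ∀ θ, D θ = liminf (fun x : ℕ ↦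
        (ENNReal.ofReal (c θ ^ 2 + n θ ^ 2 * ((x : ℝ)⁻¹) ^ 2))⁻¹) atTop := by
      intro θ
      refine (Tendsto.liminf_eq ?_).symm
      refine tendsto_inv_iff.2 (ENNReal.tendsto_ofReal ?_)
      have : Tendsto (fun x : ℕ ↦ c θ ^ 2 + n θ ^ 2 * ((x : ℝ)⁻¹) ^ 2) atTop
          (𝓝 (c θ ^ 2 + n θ ^ 2 * 0 ^ 2)) :=
        ((tendsto_inv_atTop_nhds_zero_nat.pow 2).const_mul _).const_add _
      simpa using this
    calc ∫⁻ θ, D θ ∂ν = ∫⁻ θ, liminf (fun x : ℕ ↦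
          (ENNReal.ofReal (c θ ^ 2 + n θ ^ 2 * ((x : ℝ)⁻¹) ^ 2))⁻¹) atTop ∂ν :=
          lintegral_congr hpt
      _ ≤ liminf (fun x : ℕ ↦ ∫⁻ θ,
          (ENNReal.ofReal (c θ ^ 2 + n θ ^ 2 * ((x : ℝ)⁻¹) ^ 2))⁻¹ ∂ν) atTop := by
          refine lintegral_liminf_le fun x ↦ ?_
          have : Measurable fun θ ↦ c θ ^ 2 + n θ ^ 2 * ((x : ℝ)⁻¹) ^ 2 :=
            Continuous.measurable (by fun_prop)
          exact this.ennreal_ofReal.inv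
      _ = 1 := by
          refine Tendsto.liminf_eq ?_
          have h1 : Tendsto (fun x : ℕ ↦ ENNReal.ofReal (((x : ℝ) : ℂ) * h (x : ℝ)).re) atTop
              (𝓝 (ENNReal.ofReal (1 : ℂ).re)) :=
            ENNReal.tendsto_ofReal ((Complex.continuous_re.tendsto 1).comp
              (hn.comp tendsto_natCast_atTop_atTop))
          simp only [Complex.one_re, ENNReal.ofReal_one] at h1
          refine h1.congr' ?_
          filter_upwards [eventually_gt_atTop 0] with x hx
          exact (hxint x (by exact_mod_cast hx)).symm
  have hDfin : ∀ᵐ θ ∂ν, D θ < ⊤ :=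
    ae_lt_top hDm (ne_top_of_le_ne_top ENNReal.one_ne_top hD)
  have hc0 : ∀ᵐ θ ∂ν, c θ ≠ 0 := by
    filter_upwards [hDfin] with θ hθ h0
    simp [D, h0] at hθ
  have hDr : ∀ θ, (D θ).toReal = (c θ ^ 2)⁻¹ := fun θ ↦ by
    simp only [D]
    rw [ENNReal.toReal_inv, ENNReal.toReal_ofReal (sq_nonneg _)]
  let T : ℝ → ℝ := fun θ ↦ n θ / c θ
  have hTm : Measurable T := hnc.measurable.div hcc.measurable
  have hDi : Integrable (fun θ ↦ (D θ).toReal) ν :=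
    integrable_toReal_of_lintegral_ne_top hDm.aemeasurable
      (ne_top_of_le_ne_top ENNReal.one_ne_top hD)
  have hTi : Integrable T ν := by
    refine hDi.mono' hTm.aestronglyMeasurable ?_
    filter_upwards [hc0] with θ hθ
    rw [hDr, Real.norm_eq_abs]
    have h1 : T θ = n θ * c θ * (c θ ^ 2)⁻¹ := by simp only [T]; field_simp
    have h2 : |n θ * c θ| ≤ 1 := by
      rw [abs_le]
      have := hcn θ
      constructor <;> nlinarith [sq_nonneg (n θ + c θ), sq_nonneg (n θ - c θ)]
    rw [h1, abs_mul, abs_of_nonneg (inv_nonneg.2 (sq_nonneg (c θ)))]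
    exact mul_le_of_le_one_left (by positivity) h2
  let κ : Measure ℝ := (ν.withDensity D).map T
  have : IsFiniteMeasure (ν.withDensity D) :=
    isFiniteMeasure_withDensity (ne_top_of_le_ne_top ENNReal.one_ne_top hD)
  have hκ : IsFiniteMeasure κ := inferInstance
  let A : ℂ := Complex.I * (∫ θ, T θ ∂ν : ℝ) + (h 1).im * Complex.I
  have hkey : ∀ s ∈ rightHalfPlane, h s = ∫ t : ℝ, 1 / (s + t * Complex.I) ∂κ + A := by
    intro s hs
    have h1 : ∫ t : ℝ, 1 / (s + t * Complex.I) ∂κ =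
        ∫ θ, (D θ).toReal • (1 / (s + T θ * Complex.I)) ∂ν := by
      rw [integral_map hTm.aemeasurable
        (continuous_one_div_add_ofReal_mul_I hs).aestronglyMeasurable]
      exact integral_withDensity_eq_integral_toReal_smul hDm hDfin _
    have h2 : Integrable (fun θ ↦ (D θ).toReal • (1 / (s + T θ * Complex.I))) ν := by
      refine hDi.smul_bdd (1 / s.re) ?_ ?_
      · exact ((continuous_one_div_add_ofReal_mul_I hs).measurable.comp
          hTm).aestronglyMeasurable
      · exact .of_forall fun θ ↦ norm_one_div_add_ofReal_mul_I_le hs _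
    -- Dividing by `cos(θ/2)` splits the kernel as `(1 + T²) / (s + iT) + iT`, where `1 + T² = D`.
    -- The second term does not depend on `s` and goes into the constant `A`.
    have h3 : ∫ θ, k s θ ∂ν = ∫ θ, ((D θ).toReal • (1 / (s + T θ * Complex.I)) +
        Complex.I * (T θ : ℂ)) ∂ν := by
      refine integral_congr_ae ?_
      filter_upwards [hc0] with θ hθ
      have hθ' : (c θ : ℂ) ≠ 0 := by exact_mod_cast hθ
      have h5 := add_ofReal_mul_I_ne_zero hs (T θ)
      have hcn' : (c θ : ℂ) ^ 2 + (n θ : ℂ) ^ 2 = 1 := by exact_mod_cast hcn θ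
      have h6 : s * c θ + Complex.I * n θ = c θ * (s + T θ * Complex.I) := by
        simp only [T]; push_cast; field_simp
      have h7 : (c θ : ℂ) * T θ = n θ := by simp only [T]; push_cast; field_simp
      rw [hDr]
      simp only [k, Complex.real_smul]
      rw [← h7] at hcn'
      have h8 : ((c θ : ℂ) ^ 2)⁻¹ * (1 / (s + T θ * Complex.I)) *
          (c θ * (s + T θ * Complex.I)) = (c θ : ℂ)⁻¹ := by field_simp
      have h9 : (c θ : ℂ)⁻¹ = c θ + c θ * T θ ^ 2 := by
        refine inv_eq_of_mul_eq_one_right ?_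
        linear_combination hcn'
      rw [h6, div_eq_iff (mul_ne_zero hθ' h5), add_mul]
      push_cast
      rw [h8, h9, ← h7]
      linear_combination -(c θ : ℂ) * T θ ^ 2 * Complex.I_sq
    have h4 : Integrable (fun θ ↦ Complex.I * (T θ : ℂ)) ν := hTi.ofReal.const_mul _
    rw [hk s hs, h3, integral_add h2 h4, h1, integral_const_mul]
    have h5 : ∫ θ, (T θ : ℂ) ∂ν = (∫ θ, T θ ∂ν : ℝ) := integral_ofReal
    rw [h5]
    simp only [A]
    ring
  have hlim := tendsto_mul_integral_one_div_add_ofReal_mul_I κ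
  have hinv : Tendsto (fun x : ℝ ↦ ((x⁻¹ : ℝ) : ℂ)) atTop (𝓝 0) := by
    have := (Complex.continuous_ofReal.tendsto 0).comp tendsto_inv_atTop_zero
    simpa [Function.comp_def] using this
  -- Both `x h(x)` and `x` times the Cauchy transform converge, so their difference divided by `x`,
  -- which is `A`, tends to `0`.
  have hA : A = 0 := by
    have h1 := hinv.mul (hn.sub hlim)
    rw [zero_mul] at h1
    refine tendsto_nhds_unique (f := fun _ : ℝ ↦ A) (l := atTop) tendsto_const_nhds (h1.congr' ?_)
    filter_upwards [eventually_gt_atTop 0] with x hx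
    have hx' : (x : ℂ) ≠ 0 := by exact_mod_cast hx.ne'
    rw [hkey _ (ofReal_mem_rightHalfPlane hx), Complex.ofReal_inv, ← mul_sub, add_sub_cancel_left,
      inv_mul_cancel_left₀ hx']
  have hrep' : ∀ s ∈ rightHalfPlane, h s = ∫ t : ℝ, 1 / (s + t * Complex.I) ∂κ := by
    intro s hs
    rw [hkey s hs, hA, add_zero]
  refine ⟨κ, ?_, hrep'⟩
  have hu : (κ.real Set.univ : ℂ) = 1 := by
    refine tendsto_nhds_unique hlim (hn.congr' ?_)
    filter_upwards [eventually_gt_atTop 0] with x hx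
    rw [hrep' _ (ofReal_mem_rightHalfPlane hx)]
  constructor
  have : κ.real Set.univ = 1 := by exact_mod_cast hu
  rw [Measure.real, ENNReal.toReal_eq_one_iff] at this
  exact this

theorem sq_add_sq_ne_zero {s : ℂ} (hs : s ∈ rightHalfPlane) (t : ℝ) : s ^ 2 + (t : ℂ) ^ 2 ≠ 0 := by
  have h1 := add_ofReal_mul_I_ne_zero hs t
  have h2 := add_ofReal_mul_I_ne_zero hs (-t)
  have : s ^ 2 + (t : ℂ) ^ 2 = (s + t * Complex.I) * (s + (-t : ℝ) * Complex.I) := by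
    push_cast
    linear_combination (t : ℂ) ^ 2 * Complex.I_sq
  rw [this]
  exact mul_ne_zero h1 h2

/-- Conjugating the kernel at `conj s` changes `t` to `-t`, and the mean of the two kernels is even
in `t`. The symmetry of `h` can then be used in place of a symmetry of the measure. -/
theorem div_sq_add_sq_eq {s : ℂ} (hs : s ∈ rightHalfPlane) (t : ℝ) :
    s / (s ^ 2 + (t : ℂ) ^ 2) =
      (1 / 2) * (1 / (s + t * Complex.I) + conj (1 / (conj s + t * Complex.I))) := by
  have h1 := add_ofReal_mul_I_ne_zero hs t
  have h2 := add_ofReal_mul_I_ne_zero hs (-t)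
  have h3 := sq_add_sq_ne_zero hs t
  push_cast at h2
  have : s ^ 2 + (t : ℂ) ^ 2 = (s + t * Complex.I) * (s - t * Complex.I) := by
    linear_combination (t : ℂ) ^ 2 * Complex.I_sq
  have h4 : s - t * Complex.I ≠ 0 := by convert h2 using 1; ring
  simp only [map_div₀, map_add, map_mul, map_one, Complex.conj_conj, Complex.conj_ofReal,
    Complex.conj_I]
  rw [this, mul_neg, ← sub_eq_add_neg]
  field_simp
  ring

/-- If in addition `h` is real on the real axis, the measure can be symmetrized. -/
theorem eq_integral_div_sq_add_sq {h : ℂ → ℂ} {κ : Measure ℝ} [IsFiniteMeasure κ]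
    (hconj : ∀ s ∈ rightHalfPlane, h (conj s) = conj (h s))
    (hκ : ∀ s ∈ rightHalfPlane, h s = ∫ t : ℝ, 1 / (s + t * Complex.I) ∂κ)
    {s : ℂ} (hs : s ∈ rightHalfPlane) : h s = ∫ t : ℝ, s / (s ^ 2 + (t : ℂ) ^ 2) ∂κ := by
  have hs' := conj_mem_rightHalfPlane hs
  have h1 : h s = ∫ t : ℝ, conj (1 / (conj s + t * Complex.I)) ∂κ := by
    rw [integral_conj, ← hκ _ hs', hconj s hs, Complex.conj_conj]
  simp_rw [div_sq_add_sq_eq hs]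
  have h2 : Integrable (fun t : ℝ ↦ conj (1 / (conj s + t * Complex.I))) κ :=
    Complex.conjCLE.toContinuousLinearMap.integrable_comp (integrable_one_div_add_ofReal_mul_I hs')
  rw [integral_const_mul, integral_add (integrable_one_div_add_ofReal_mul_I hs) h2,
    ← hκ s hs, ← h1]
  ring

/-! ### From distributional boundary positivity to positivity inside -/

/-- The average `∫ h(s + i u) φ(u) du` of `h` along the vertical line through `s`. -/
noncomputable def verticalAverage (h : ℂ → ℂ) (φ : ℝ → ℝ) (s : ℂ) : ℂ :=
  ∫ u : ℝ, h (s + u * Complex.I) * (φ u : ℂ)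

theorem add_ofReal_mul_I_mem_rightHalfPlane {s : ℂ} (hs : s ∈ rightHalfPlane) (u : ℝ) :
    s + u * Complex.I ∈ rightHalfPlane := by
  simpa [rightHalfPlane] using hs

section VerticalAverage

variable {h : ℂ → ℂ} {C : ℝ}

/-- Cauchy's estimate on the disc of radius `r`, which stays at distance `r` from the imaginary
axis. -/
theorem norm_deriv_le_of_norm_le_div_re (hd : DifferentiableOn ℂ h rightHalfPlane)
    (hC : ∀ s ∈ rightHalfPlane, ‖h s‖ ≤ C / s.re) {r : ℝ} (hr : 0 < r) {z : ℂ}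
    (hz : 2 * r ≤ z.re) : ‖deriv h z‖ ≤ C / r / r := by
  have hC0 : 0 ≤ C := by
    have := (norm_nonneg _).trans (hC 1 (by simp [rightHalfPlane]))
    simpa using this
  have hsub : ∀ w ∈ Metric.closedBall z r, r ≤ w.re := by
    intro w hw
    have h1 : |(w - z).re| ≤ r := (Complex.abs_re_le_norm _).trans (by simpa [dist_eq_norm] using hw)
    have := (abs_le.1 h1).1
    simp at this
    linarith
  have hcl : Metric.closedBall z r ⊆ rightHalfPlane := fun w hw ↦ hr.trans_le (hsub w hw)
  refine Complex.norm_deriv_le_of_forall_mem_sphere_norm_le hr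
    ⟨hd.mono (Metric.ball_subset_closedBall.trans hcl), ?_⟩ fun w hw ↦ ?_
  · rw [closure_ball _ hr.ne']
    exact (hd.mono hcl).continuousOn
  · have hw' := Metric.sphere_subset_closedBall hw
    exact (hC w (hcl hw')).trans (div_le_div_of_nonneg_left hC0 hr (hsub w hw'))

theorem continuous_comp_add_ofReal_mul_I {g : ℂ → ℂ} (hg : ContinuousOn g rightHalfPlane) {s : ℂ}
    (hs : s ∈ rightHalfPlane) : Continuous fun u : ℝ ↦ g (s + u * Complex.I) :=
  hg.comp_continuous (by fun_prop) (add_ofReal_mul_I_mem_rightHalfPlane hs)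

theorem integrable_comp_add_ofReal_mul_I_mul {g : ℂ → ℂ} (hg : ContinuousOn g rightHalfPlane)
    {φ : ℝ → ℝ} (hφ : Continuous φ) (hc : HasCompactSupport φ) {s : ℂ} (hs : s ∈ rightHalfPlane) :
    Integrable fun u : ℝ ↦ g (s + u * Complex.I) * (φ u : ℂ) := by
  refine Continuous.integrable_of_hasCompactSupport
    ((continuous_comp_add_ofReal_mul_I hg hs).mul (by fun_prop)) ?_
  have : HasCompactSupport fun u : ℝ ↦ (φ u : ℂ) := hc.comp_left (g := Complex.ofReal) rfl
  exact this.mul_left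

/-- Differentiation under the integral falls on `h`, and integration by parts moves it to `φ`. The
derivative is again a vertical average of `h` itself, so it obeys bounds of the same type. -/
theorem hasDerivAt_verticalAverage (hd : DifferentiableOn ℂ h rightHalfPlane)
    (hC : ∀ s ∈ rightHalfPlane, ‖h s‖ ≤ C / s.re) {φ : ℝ → ℝ} (hφ : ContDiff ℝ ∞ φ)
    (hc : HasCompactSupport φ) {s : ℂ} (hs : s ∈ rightHalfPlane) :
    HasDerivAt (verticalAverage h φ) (Complex.I * verticalAverage h (deriv φ) s) s := by
  have hs' : 0 < s.re := hs
  have hd' : ∀ z ∈ rightHalfPlane, HasDerivAt h (deriv h z) z := fun z hz ↦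
    (hd.differentiableAt (isOpen_rightHalfPlane.mem_nhds hz)).hasDerivAt
  have hdc : ContinuousOn (deriv h) rightHalfPlane :=
    (hd.deriv isOpen_rightHalfPlane).continuousOn
  have hφc : Continuous (deriv φ) := hφ.continuous_deriv (by simp)
  have hφd : Differentiable ℝ φ := hφ.differentiable (by simp)
  have hball : ∀ z ∈ Metric.ball s (s.re / 2), s.re / 2 ≤ z.re := by
    intro z hz
    have h1 : |(z - s).re| ≤ s.re / 2 :=
      (Complex.abs_re_le_norm _).trans (by simpa [dist_eq_norm] using (Metric.mem_ball.1 hz).le)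
    have := (abs_le.1 h1).1
    simp at this
    linarith
  have key := hasDerivAt_integral_of_dominated_loc_of_deriv_le (μ := (volume : Measure ℝ))
    (F := fun z u ↦ h (z + u * Complex.I) * (φ u : ℂ))
    (F' := fun z u ↦ deriv h (z + u * Complex.I) * (φ u : ℂ)) (x₀ := s)
    (bound := fun u ↦ C / (s.re / 4) / (s.re / 4) * ‖φ u‖)
    (Metric.ball_mem_nhds s (half_pos hs')) ?_ ?_ ?_ ?_ ?_ ?_
  · have hIBP := integral_mul_deriv_eq_deriv_mul_of_integrable
      (u := fun u : ℝ ↦ h (s + u * Complex.I)) (v := fun u ↦ (φ u : ℂ))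
      (u' := fun u : ℝ ↦ deriv h (s + u * Complex.I) * Complex.I)
      (v' := fun u ↦ ((deriv φ u : ℝ) : ℂ)) ?_ ?_ ?_ ?_ ?_
    · have h2 : ∫ u : ℝ, deriv h (s + u * Complex.I) * Complex.I * (φ u : ℂ) =
          Complex.I * ∫ u : ℝ, deriv h (s + u * Complex.I) * (φ u : ℂ) := by
        rw [← integral_const_mul]
        congr 1
        ext u
        ring
      rw [h2] at hIBP
      have h3 : Complex.I * verticalAverage h (deriv φ) s =
          ∫ u : ℝ, deriv h (s + u * Complex.I) * (φ u : ℂ) := by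
        simp only [verticalAverage]
        rw [hIBP]
        linear_combination (-∫ u : ℝ, deriv h (s + u * Complex.I) * (φ u : ℂ)) * Complex.I_sq
      rw [h3]
      exact key.2
    · intro u _
      have h1 : HasDerivAt (fun u : ℝ ↦ s + u * Complex.I) Complex.I u := by
        simpa using ((Complex.ofRealCLM.hasDerivAt (x := u)).mul_const Complex.I).const_add s
      have := (hd' _ (add_ofReal_mul_I_mem_rightHalfPlane hs u)).scomp u h1
      simpa [mul_comm, Function.comp_def] using this
    · intro u _
      exact (hφd u).hasDerivAt.ofReal_comp
    · exact integrable_comp_add_ofReal_mul_I_mul hd.continuousOn hφc hc.deriv hs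
    · have := (integrable_comp_add_ofReal_mul_I_mul hdc hφ.continuous hc hs).const_mul Complex.I
      refine this.congr (.of_forall fun u ↦ ?_)
      simp only [Pi.mul_apply]
      ring
    · exact integrable_comp_add_ofReal_mul_I_mul hd.continuousOn hφ.continuous hc hs
  · filter_upwards [isOpen_rightHalfPlane.mem_nhds hs] with z hz
    exact (integrable_comp_add_ofReal_mul_I_mul hd.continuousOn hφ.continuous hc
      hz).aestronglyMeasurable
  · exact integrable_comp_add_ofReal_mul_I_mul hd.continuousOn hφ.continuous hc hs
  · exact (integrable_comp_add_ofReal_mul_I_mul hdc hφ.continuous hc hs).aestronglyMeasurable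
  · refine .of_forall fun u z hz ↦ ?_
    rw [norm_mul, Complex.norm_real]
    gcongr
    refine norm_deriv_le_of_norm_le_div_re hd hC (by positivity) ?_
    have := hball z hz
    simp
    linarith
  · exact (hφ.continuous.norm.integrable_of_hasCompactSupport hc.norm).const_mul _
  · refine .of_forall fun u z hz ↦ ?_
    have hz' : z ∈ rightHalfPlane := (half_pos hs').trans_le (hball z hz)
    have h1 : HasDerivAt (fun z : ℂ ↦ z + u * Complex.I) 1 z := (hasDerivAt_id z).add_const _
    have := (hd' _ (add_ofReal_mul_I_mem_rightHalfPlane hz' u)).comp z h1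
    simpa [Function.comp_def] using this.mul_const (φ u : ℂ)

theorem norm_verticalAverage_le_div_re
    (hC : ∀ s ∈ rightHalfPlane, ‖h s‖ ≤ C / s.re) {φ : ℝ → ℝ} (hφ : Continuous φ)
    (hc : HasCompactSupport φ) :
    ∃ D : ℝ, 0 ≤ D ∧ ∀ s ∈ rightHalfPlane, ‖verticalAverage h φ s‖ ≤ D / s.re := by
  have hC0 : 0 ≤ C := by
    have := (norm_nonneg _).trans (hC 1 (by simp [rightHalfPlane]))
    simpa using this
  have hi : Integrable fun u ↦ ‖φ u‖ := hφ.norm.integrable_of_hasCompactSupport hc.norm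
  refine ⟨C * ∫ u, ‖φ u‖, mul_nonneg hC0 (integral_nonneg fun _ ↦ norm_nonneg _), fun s hs ↦ ?_⟩
  rw [verticalAverage, mul_div_right_comm, ← integral_const_mul]
  refine norm_integral_le_of_norm_le (hi.const_mul _) (.of_forall fun u ↦ ?_)
  rw [norm_mul, Complex.norm_real]
  gcongr
  simpa using hC _ (add_ofReal_mul_I_mem_rightHalfPlane hs u)

/-- The fundamental theorem of calculus on the horizontal segment from `s` to the line `Re = 1`.
Each use gains one integration of the bound in `Re s`. -/
theorem norm_verticalAverage_le_add_integral (hd : DifferentiableOn ℂ h rightHalfPlane)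
    (hC : ∀ s ∈ rightHalfPlane, ‖h s‖ ≤ C / s.re) {φ : ℝ → ℝ} (hφ : ContDiff ℝ ∞ φ)
    (hc : HasCompactSupport φ) {b : ℝ → ℝ}
    (hb : ∀ s ∈ rightHalfPlane, s.re ≤ 1 → ‖verticalAverage h (deriv φ) s‖ ≤ b s.re)
    {s : ℂ} (hs : s ∈ rightHalfPlane) (hs1 : s.re ≤ 1)
    (hbi : IntervalIntegrable b volume s.re 1) :
    ‖verticalAverage h φ s‖ ≤
      ‖verticalAverage h φ (1 + s.im * Complex.I)‖ + ∫ x in s.re..1, b x := by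
  have hs' : 0 < s.re := hs
  let p : ℝ → ℂ := fun x ↦ x + s.im * Complex.I
  have hp : ∀ x ∈ Set.uIcc s.re 1, p x ∈ rightHalfPlane := by
    intro x hx
    rw [Set.uIcc_of_le hs1] at hx
    have : 0 < x := hs'.trans_le hx.1
    simpa [p, rightHalfPlane] using this
  have hderiv : ∀ x ∈ Set.uIcc s.re 1, HasDerivAt (fun x ↦ verticalAverage h φ (p x))
      (Complex.I * verticalAverage h (deriv φ) (p x)) x := by
    intro x hx
    have h1 : HasDerivAt p 1 x := by
      simpa [p] using (Complex.ofRealCLM.hasDerivAt (x := x)).add_const (s.im * Complex.I)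
    have := (hasDerivAt_verticalAverage hd hC hφ hc (hp x hx)).scomp x h1
    simpa [Function.comp_def] using this
  have hdφ : ContDiff ℝ ∞ (deriv φ) := by
    have := hφ.iterate_deriv 1
    simpa using this
  have hcont : ContinuousOn (fun x ↦ Complex.I * verticalAverage h (deriv φ) (p x))
      (Set.uIcc s.re 1) := by
    intro x hx
    have h1 := (hasDerivAt_verticalAverage hd hC hdφ hc.deriv (hp x hx)).continuousAt
    have h2 : ContinuousAt p x := by fun_prop
    exact (continuousAt_const.mul (h1.comp (f := p) h2)).continuousWithinAt
  have hftc := intervalIntegral.integral_eq_sub_of_hasDerivAt hderiv hcont.intervalIntegrable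
  have hpe : p s.re = s := by simp [p, Complex.re_add_im]
  have hp1 : p 1 = 1 + s.im * Complex.I := by simp [p]
  rw [hpe, hp1] at hftc
  have hle : ‖∫ x in s.re..1, Complex.I * verticalAverage h (deriv φ) (p x)‖ ≤
      ∫ x in s.re..1, b x := by
    refine intervalIntegral.norm_integral_le_of_norm_le hs1 (.of_forall fun x hx ↦ ?_) hbi
    rw [norm_mul, Complex.norm_I, one_mul]
    have hx' : x ∈ Set.uIcc s.re 1 := by
      rw [Set.uIcc_of_le hs1]; exact Set.Ioc_subset_Icc_self hx
    have h1 : (p x).re = x := by simp [p]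
    have := hb _ (hp x hx') (by rw [h1]; exact hx.2)
    rwa [h1] at this
  have : verticalAverage h φ s = verticalAverage h φ (1 + s.im * Complex.I) -
      ∫ x in s.re..1, Complex.I * verticalAverage h (deriv φ) (p x) := by
    rw [hftc]; ring
  rw [this]
  exact (norm_sub_le _ _).trans (by gcongr)

theorem contDiff_deriv_of_contDiff_infty {φ : ℝ → ℝ} (hφ : ContDiff ℝ ∞ φ) :
    ContDiff ℝ ∞ (deriv φ) := by
  have := hφ.iterate_deriv 1
  simpa using this

/-- The vertical averages of a function that is `O(1 / Re s)` are bounded. -/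
theorem exists_norm_verticalAverage_le (hd : DifferentiableOn ℂ h rightHalfPlane)
    (hC : ∀ s ∈ rightHalfPlane, ‖h s‖ ≤ C / s.re) {φ : ℝ → ℝ} (hφ : ContDiff ℝ ∞ φ)
    (hc : HasCompactSupport φ) :
    ∃ D : ℝ, 0 ≤ D ∧ ∀ s ∈ rightHalfPlane, ‖verticalAverage h φ s‖ ≤ D := by
  have hone : ∀ t : ℝ, (1 + t * Complex.I : ℂ) ∈ rightHalfPlane := fun t ↦
    add_ofReal_mul_I_mem_rightHalfPlane (by simp [rightHalfPlane]) t
  -- a logarithmic bound for all averages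
  have hlog : ∀ ψ : ℝ → ℝ, ContDiff ℝ ∞ ψ → HasCompactSupport ψ → ∃ D : ℝ, 0 ≤ D ∧
      ∀ s ∈ rightHalfPlane, s.re ≤ 1 → ‖verticalAverage h ψ s‖ ≤ D * (1 - Real.log s.re) := by
    intro ψ hψ hcψ
    obtain ⟨D₀, hD₀, h₀⟩ := norm_verticalAverage_le_div_re hC hψ.continuous hcψ
    obtain ⟨D₁, hD₁, h₁⟩ := norm_verticalAverage_le_div_re hC
      (contDiff_deriv_of_contDiff_infty hψ).continuous hcψ.deriv
    refine ⟨D₀ + D₁, by positivity, fun s hs hs1 ↦ ?_⟩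
    have hs' : 0 < s.re := hs
    have hi : IntervalIntegrable (fun x : ℝ ↦ D₁ * x⁻¹) volume s.re 1 := by
      refine (intervalIntegral.intervalIntegrable_inv ?_ continuousOn_id).const_mul _
      intro x hx
      rw [Set.uIcc_of_le hs1] at hx
      exact (hs'.trans_le hx.1).ne'
    have := norm_verticalAverage_le_add_integral hd hC hψ hcψ (b := fun x ↦ D₁ * x⁻¹)
      (fun z hz _ ↦ by simpa [div_eq_mul_inv] using h₁ z hz) hs hs1 hi
    rw [intervalIntegral.integral_const_mul, integral_inv_of_pos hs' one_pos, one_div,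
      Real.log_inv] at this
    have h2 := h₀ _ (hone s.im)
    simp at h2
    have h3 : Real.log s.re ≤ 0 := Real.log_nonpos hs'.le hs1
    nlinarith
  -- Second integration: the logarithmic bound for the average against `φ'` is integrable at `0`, so
  -- the average against `φ` is bounded.
  obtain ⟨D₀, hD₀, h₀⟩ := norm_verticalAverage_le_div_re hC hφ.continuous hc
  obtain ⟨D₁, hD₁, h₁⟩ := hlog _ (contDiff_deriv_of_contDiff_infty hφ) hc.deriv
  refine ⟨D₀ + 2 * D₁, by positivity, fun s hs ↦ ?_⟩
  have hs' : 0 < s.re := hs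
  rcases le_total s.re 1 with hs1 | hs1
  · have hi : IntervalIntegrable (fun x : ℝ ↦ D₁ * (1 - Real.log x)) volume s.re 1 :=
      (intervalIntegrable_const.sub
        intervalIntegral.intervalIntegrable_log').const_mul _
    have := norm_verticalAverage_le_add_integral hd hC hφ hc h₁ hs hs1 hi
    rw [intervalIntegral.integral_const_mul, intervalIntegral.integral_sub
      intervalIntegrable_const intervalIntegral.intervalIntegrable_log',
      integral_log, intervalIntegral.integral_const] at this
    have h2 := h₀ _ (hone s.im)
    simp at h2 this
    have h3 : s.re * Real.log s.re ≤ 0 :=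
      mul_nonpos_of_nonneg_of_nonpos hs'.le (Real.log_nonpos hs'.le hs1)
    nlinarith
  · calc ‖verticalAverage h φ s‖ ≤ D₀ / s.re := h₀ s hs
      _ ≤ D₀ := div_le_self hD₀ hs1
      _ ≤ D₀ + 2 * D₁ := by linarith

theorem re_verticalAverage (hd : DifferentiableOn ℂ h rightHalfPlane) {φ : ℝ → ℝ}
    (hφ : Continuous φ) (hc : HasCompactSupport φ) {s : ℂ} (hs : s ∈ rightHalfPlane) :
    (verticalAverage h φ s).re = ∫ u : ℝ, (h (s + u * Complex.I)).re * φ u := by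
  have := integral_re (integrable_comp_add_ofReal_mul_I_mul hd.continuousOn hφ hc hs)
  simp only [RCLike.re_to_complex] at this
  rw [verticalAverage, ← this]
  congr 1
  ext u
  simp

/-- The averages of a function with nonnegative distributional boundary values have
nonnegative real part, by the Phragmén–Lindelöf principle. -/
theorem re_verticalAverage_nonneg (hd : DifferentiableOn ℂ h rightHalfPlane)
    (hC : ∀ s ∈ rightHalfPlane, ‖h s‖ ≤ C / s.re) (hb : HasNonnegBoundaryRe h) {φ : ℝ → ℝ}
    (hφ : ContDiff ℝ ∞ φ) (hc : HasCompactSupport φ) (hφ0 : ∀ t, 0 ≤ φ t)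
    {s : ℂ} (hs : s ∈ rightHalfPlane) : 0 ≤ (verticalAverage h φ s).re := by
  obtain ⟨D, hD, hbound⟩ := exists_norm_verticalAverage_le hd hC hφ hc
  obtain ⟨D', hD', hbound'⟩ := exists_norm_verticalAverage_le hd hC
    (contDiff_deriv_of_contDiff_infty hφ) hc.deriv
  have hconv : Convex ℝ rightHalfPlane := convex_halfSpace_re_gt 0
  have hlip : LipschitzOnWith D'.toNNReal (verticalAverage h φ) rightHalfPlane := by
    refine hconv.lipschitzOnWith_of_nnnorm_hasDerivWithin_le (𝕜 := ℂ)
      (fun z hz ↦ (hasDerivAt_verticalAverage hd hC hφ hc hz).hasDerivWithinAt) fun z hz ↦ ?_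
    rw [← NNReal.coe_le_coe, coe_nnnorm, Real.coe_toNNReal _ hD', norm_mul, Complex.norm_I,
      one_mul]
    exact hbound' z hz
  -- The Lipschitz extension to the whole plane serves only to supply continuous values on the
  -- imaginary axis.
  obtain ⟨g, hg, heq⟩ := hlip.extend_finite_dimension
  have hdiff : DifferentiableOn ℂ g rightHalfPlane :=
    DifferentiableOn.congr (fun z hz ↦
      (hasDerivAt_verticalAverage hd hC hφ hc hz).differentiableAt.differentiableWithinAt)
      fun z hz ↦ (heq hz).symm
  have hbd : ∀ t : ℝ, 0 ≤ (g (t * Complex.I)).re := by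
    -- The boundary value at `it` is the distributional limit tested against `φ` translated by `t`.
    intro t
    obtain ⟨l, hl, hlim⟩ := hb (fun x ↦ φ (x - t)) (hφ.comp (contDiff_id.sub contDiff_const))
      (hc.comp_homeomorph (Homeomorph.subRight t)) fun x ↦ hφ0 _
    have h1 : Tendsto (fun ε : ℝ ↦ (g (ε + t * Complex.I)).re) (𝓝[>] 0)
        (𝓝 (g (t * Complex.I)).re) := by
      have : Continuous fun ε : ℝ ↦ (g (ε + t * Complex.I)).re :=
        Complex.continuous_re.comp (hg.continuous.comp (by fun_prop))
      exact (this.tendsto' 0 _ (by simp)).mono_left nhdsWithin_le_nhds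
    have : (g (t * Complex.I)).re = l := by
      refine tendsto_nhds_unique h1 (hlim.congr' ?_)
      filter_upwards [self_mem_nhdsWithin] with ε hε
      have hε' : (ε + t * Complex.I : ℂ) ∈ rightHalfPlane :=
        add_ofReal_mul_I_mem_rightHalfPlane (ofReal_mem_rightHalfPlane hε) t
      rw [← heq hε', re_verticalAverage hd hφ.continuous hc hε',
        ← integral_add_right_eq_self _ t]
      congr 1
      ext u
      rw [add_sub_cancel_right]
      congr 3
      push_cast
      ring
    rw [this]
    exact hl
  -- `|exp(-g)| = exp(-Re g)` is at most `1` on the imaginary axis and bounded inside, so the growth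
  -- exponents can be taken to be zero.
  have hPL := PhragmenLindelof.right_half_plane_of_bounded_on_real (f := fun z ↦ Complex.exp (-g z))
    (C := 1) ⟨(hdiff.neg).cexp, (hg.continuous.neg.cexp).continuousOn⟩ ⟨0, by norm_num, 0, ?_⟩ ?_ ?_
    (le_of_lt hs : 0 ≤ s.re)
  · rw [Complex.norm_exp, Real.exp_le_one_iff] at hPL
    rw [heq hs]
    simpa using hPL
  · refine Asymptotics.IsBigO.of_bound (Real.exp D) ?_
    refine Filter.eventually_inf_principal.2 (.of_forall fun z hz ↦ ?_)
    have h2 := hbound z hz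
    rw [heq hz] at h2
    simp only [Real.rpow_zero, Real.exp_zero, norm_one, mul_one, Complex.norm_exp]
    refine Real.exp_le_exp.2 ?_
    exact (Complex.re_le_norm _).trans (by simpa using h2)
  · refine isBoundedUnder_of_eventually_le (a := Real.exp D) ?_
    filter_upwards [eventually_gt_atTop 0] with x hx
    have hz := ofReal_mem_rightHalfPlane hx
    have h2 := hbound _ hz
    rw [heq hz] at h2
    rw [Complex.norm_exp]
    exact Real.exp_le_exp.2 ((Complex.re_le_norm _).trans (by simpa using h2))
  · intro x
    rw [Complex.norm_exp, Real.exp_le_one_iff]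
    simpa using hbd x

/-- A holomorphic function on the half-plane that is `O(1 / Re s)` and has nonnegative
distributional boundary values has nonnegative real part. -/
theorem re_nonneg_of_hasNonnegBoundaryRe (hd : DifferentiableOn ℂ h rightHalfPlane)
    (hC : ∀ s ∈ rightHalfPlane, ‖h s‖ ≤ C / s.re) (hb : HasNonnegBoundaryRe h)
    {s : ℂ} (hs : s ∈ rightHalfPlane) : 0 ≤ (h s).re := by
  by_contra! hneg
  have hcont : Continuous fun u : ℝ ↦ (h (s + u * Complex.I)).re :=
    Complex.continuous_re.comp (continuous_comp_add_ofReal_mul_I hd.continuousOn hs)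
  have hev : ∀ᶠ u : ℝ in 𝓝 (0 : ℝ), (h (s + u * Complex.I)).re < (h s).re / 2 := by
    refine (hcont.tendsto 0).eventually_lt_const ?_
    simp
    linarith
  obtain ⟨δ, hδ, hball⟩ := Metric.eventually_nhds_iff_ball.1 hev
  -- If `Re h(s) < 0`, a bump supported where `Re h` stays below half that value has an average of
  -- negative real part.
  let φ : ContDiffBump (0 : ℝ) := ⟨δ / 2, δ, by positivity, by linarith⟩
  have h1 := re_verticalAverage_nonneg hd hC hb φ.contDiff φ.hasCompactSupport
    (fun t ↦ φ.nonneg) hs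
  rw [re_verticalAverage hd φ.continuous φ.hasCompactSupport hs] at h1
  have h2 : ∫ u : ℝ, (h (s + u * Complex.I)).re * φ u ≤ ∫ u : ℝ, (h s).re / 2 * φ u := by
    refine integral_mono ?_ (φ.integrable.const_mul _) fun u ↦ ?_
    · exact (hcont.mul φ.continuous).integrable_of_hasCompactSupport φ.hasCompactSupport.mul_left
    · by_cases hu : u ∈ Metric.ball (0 : ℝ) δ
      · exact mul_le_mul_of_nonneg_right (hball u hu).le φ.nonneg
      · have : φ u = 0 := by
          have := φ.support_eq
          by_contra h0
          exact hu (this ▸ h0)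
        simp [this]
  rw [integral_const_mul] at h2
  have h3 : 0 < ∫ u : ℝ, φ u := φ.integral_pos
  nlinarith

end VerticalAverage

/-! ### The principal square root between slit plane and half-plane -/

section SquareRoot

theorem sq_mem_slitPlane {s : ℂ} (hs : s ∈ rightHalfPlane) : s ^ 2 ∈ Complex.slitPlane := by
  have hs' : 0 < s.re := hs
  rw [Complex.mem_slitPlane_iff]
  by_cases h : s.im = 0
  · left
    rw [pow_two, Complex.mul_re, h]
    nlinarith
  · right
    rw [pow_two, Complex.mul_im]
    intro h0
    have : s.re * s.im = 0 := by linarith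
    rcases mul_eq_zero.1 this with h1 | h1
    · exact hs'.ne' h1
    · exact h h1

theorem sq_cpow_half {s : ℂ} (hs : s ∈ rightHalfPlane) : (s ^ 2) ^ (1 / 2 : ℂ) = s := by
  rw [one_div]
  exact Complex.sq_cpow_two_inv hs

theorem cpow_half_sq (z : ℂ) : (z ^ (1 / 2 : ℂ)) ^ 2 = z := by
  rw [one_div]
  exact_mod_cast Complex.cpow_nat_inv_pow z two_ne_zero

theorem cpow_half_mem_rightHalfPlane {z : ℂ} (hz : z ∈ Complex.slitPlane) :
    z ^ (1 / 2 : ℂ) ∈ rightHalfPlane := by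
  obtain ⟨h1, h2⟩ := Complex.mem_slitPlane_iff_arg.1 hz
  change 0 < (z ^ (1 / 2 : ℂ)).re
  rw [Complex.cpow_def_of_ne_zero h2, Complex.exp_re]
  refine mul_pos (Real.exp_pos _) (Real.cos_pos_of_mem_Ioo ?_)
  have h3 : (Complex.log z * (1 / 2)).im = z.arg / 2 := by
    have : (1 / 2 : ℂ) = ((1 / 2 : ℝ) : ℂ) := by push_cast; ring
    rw [this, Complex.im_mul_ofReal, Complex.log_im]
    ring
  have h4 := Complex.neg_pi_lt_arg z
  have h5 := lt_of_le_of_ne (Complex.arg_le_pi z) h1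
  rw [h3]
  constructor <;> linarith

theorem cpow_neg_half_mul_cpow_half {z : ℂ} (hz : z ≠ 0) :
    z ^ (-(1 / 2) : ℂ) * z ^ (1 / 2 : ℂ) = 1 := by
  rw [← Complex.cpow_add _ _ hz, neg_add_cancel, Complex.cpow_zero]

end SquareRoot

/-! ### Cauchy transforms are passive -/

section CauchyTransform

variable {κ : Measure ℝ}

/-- The measure `κ`, made symmetric about the origin. -/
noncomputable def symmetrization (κ : Measure ℝ) : Measure ℝ :=
  (2⁻¹ : NNReal) • (κ + κ.map Neg.neg)

instance [IsProbabilityMeasure κ] : IsProbabilityMeasure (symmetrization κ) := by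
  constructor
  rw [symmetrization, Measure.smul_apply, Measure.add_apply,
    Measure.map_apply measurable_neg MeasurableSet.univ, Set.preimage_univ, measure_univ]
  rw [ENNReal.smul_def, smul_eq_mul, one_add_one_eq_two, ENNReal.coe_inv two_ne_zero]
  exact ENNReal.inv_mul_cancel two_ne_zero ENNReal.ofNat_ne_top

/-- The even kernel against `κ` becomes a plain Cauchy transform of a symmetric measure, so the
estimates for `1 / (s + it)` apply to it. -/
theorem integral_symmetrization [IsFiniteMeasure κ] {s : ℂ} (hs : s ∈ rightHalfPlane) :
    ∫ t : ℝ, 1 / (s + t * Complex.I) ∂(symmetrization κ) =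
      ∫ t : ℝ, s / (s ^ 2 + (t : ℂ) ^ 2) ∂κ := by
  have hc := continuous_one_div_add_ofReal_mul_I hs
  have hi := integrable_one_div_add_ofReal_mul_I (κ := κ) hs
  have hi' := integrable_one_div_add_ofReal_mul_I (κ := κ.map Neg.neg) hs
  have hi'' : Integrable (fun t : ℝ ↦ 1 / (s + (-t : ℝ) * Complex.I)) κ :=
    (integrable_map_measure hc.aestronglyMeasurable measurable_neg.aemeasurable).1 hi'
  rw [symmetrization, integral_smul_nnreal_measure, integral_add_measure hi hi',
    integral_map measurable_neg.aemeasurable hc.aestronglyMeasurable, ← integral_add hi hi'',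
    NNReal.smul_def, Complex.real_smul, ← integral_const_mul]
  congr 1
  ext t
  have h1 := add_ofReal_mul_I_ne_zero hs t
  have h2 := add_ofReal_mul_I_ne_zero hs (-t)
  have h3 := sq_add_sq_ne_zero hs t
  have h4 : s ^ 2 + (t : ℂ) ^ 2 = (s + t * Complex.I) * (s + (-t : ℝ) * Complex.I) := by
    push_cast
    linear_combination (t : ℂ) ^ 2 * Complex.I_sq
  have h5 : s = ((s + t * Complex.I) + (s + (-t : ℝ) * Complex.I)) / 2 := by push_cast; ring
  rw [h4]
  generalize s + t * Complex.I = a at *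
  generalize s + (-t : ℝ) * Complex.I = b at *
  rw [h5]
  push_cast
  field_simp
  ring

theorem differentiableOn_integral_one_div_add_ofReal_mul_I [IsFiniteMeasure κ] :
    DifferentiableOn ℂ (fun s ↦ ∫ t : ℝ, 1 / (s + t * Complex.I) ∂κ) rightHalfPlane := by
  intro s hs
  have hs' : 0 < s.re := hs
  have hball : ∀ z ∈ Metric.ball s (s.re / 2), s.re / 2 ≤ z.re := by
    intro z hz
    have h1 : |(z - s).re| ≤ s.re / 2 :=
      (Complex.abs_re_le_norm _).trans (by simpa [dist_eq_norm] using (Metric.mem_ball.1 hz).le)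
    have := (abs_le.1 h1).1
    simp at this
    linarith
  have hball' : ∀ z ∈ Metric.ball s (s.re / 2), z ∈ rightHalfPlane := fun z hz ↦
    (half_pos hs').trans_le (hball z hz)
  have key := hasDerivAt_integral_of_dominated_loc_of_deriv_le (μ := κ)
    (F := fun z t ↦ 1 / (z + t * Complex.I)) (F' := fun z t ↦ -(1 / (z + t * Complex.I)) ^ 2)
    (x₀ := s) (bound := fun _ ↦ (1 / (s.re / 2)) ^ 2) (Metric.ball_mem_nhds s (half_pos hs'))
    ?_ (integrable_one_div_add_ofReal_mul_I hs) ?_ ?_ (integrable_const _) ?_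
  · exact key.2.differentiableAt.differentiableWithinAt
  · filter_upwards [isOpen_rightHalfPlane.mem_nhds hs] with z hz
    exact (integrable_one_div_add_ofReal_mul_I hz).aestronglyMeasurable
  · exact ((continuous_one_div_add_ofReal_mul_I hs).pow 2).neg.aestronglyMeasurable
  · refine .of_forall fun t z hz ↦ ?_
    rw [norm_neg, norm_pow]
    gcongr
    exact (norm_one_div_add_ofReal_mul_I_le (hball' z hz) t).trans
      (one_div_le_one_div_of_le (half_pos hs') (hball z hz))
  · refine .of_forall fun t z hz ↦ ?_
    have h1 : HasDerivAt (fun z : ℂ ↦ z + t * Complex.I) 1 z := (hasDerivAt_id z).add_const _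
    have := h1.inv (add_ofReal_mul_I_ne_zero (hball' z hz) t)
    simpa [neg_div, Pi.inv_def] using this

theorem norm_integral_one_div_add_ofReal_mul_I_le [IsProbabilityMeasure κ] {s : ℂ}
    (hs : s ∈ rightHalfPlane) : ‖∫ t : ℝ, 1 / (s + t * Complex.I) ∂κ‖ ≤ 1 / s.re := by
  have := norm_integral_le_of_norm_le_const (μ := κ)
    (.of_forall (norm_one_div_add_ofReal_mul_I_le hs))
  simpa using this

theorem re_one_div_add (ε u t : ℝ) :
    (1 / ((ε : ℂ) + Complex.I * u + t * Complex.I)).re = ε / (ε ^ 2 + (u + t) ^ 2) := by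
  rw [one_div, Complex.inv_re, Complex.normSq_apply]
  simp
  ring

/-- The Poisson kernel of the half-plane is an approximate identity. -/
theorem integral_poissonKernel_mul {φ : ℝ → ℝ} {ε : ℝ} (hε : 0 < ε) (t : ℝ) :
    ∫ u, ε / (ε ^ 2 + (u + t) ^ 2) * φ u = ∫ x, (1 + x ^ 2)⁻¹ * φ (ε * x - t) := by
  have h1 := integral_sub_right_eq_self (μ := volume)
    (fun u ↦ ε / (ε ^ 2 + (u + t) ^ 2) * φ u) t
  have h2 := Measure.integral_comp_mul_left
    (fun y ↦ ε / (ε ^ 2 + (y - t + t) ^ 2) * φ (y - t)) ε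
  rw [← h1]
  rw [abs_of_pos (inv_pos.2 hε), smul_eq_mul] at h2
  have h3 : ∫ y, ε / (ε ^ 2 + (y - t + t) ^ 2) * φ (y - t) =
      ε * ∫ x, ε / (ε ^ 2 + (ε * x - t + t) ^ 2) * φ (ε * x - t) := by
    rw [h2, mul_inv_cancel_left₀ hε.ne']
  rw [h3, ← integral_const_mul]
  congr 1
  ext x
  have : 1 + x ^ 2 ≠ 0 := by positivity
  rw [sub_add_cancel, ← mul_assoc]
  congr 1
  field_simp

theorem integral_re_mul_eq [IsFiniteMeasure κ] {φ : ℝ → ℝ} (hφ : Continuous φ)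
    (hc : HasCompactSupport φ) {ε : ℝ} (hε : 0 < ε) :
    ∫ u : ℝ, (∫ t : ℝ, 1 / ((ε : ℂ) + Complex.I * u + t * Complex.I) ∂κ).re * φ u =
      ∫ t : ℝ, (∫ x : ℝ, (1 + x ^ 2)⁻¹ * φ (ε * x - t)) ∂κ := by
  have hmem : ∀ u : ℝ, (ε : ℂ) + Complex.I * u ∈ rightHalfPlane := fun u ↦ by
    simpa [rightHalfPlane] using hε
  have h1 : ∀ u : ℝ, (∫ t : ℝ, 1 / ((ε : ℂ) + Complex.I * u + t * Complex.I) ∂κ).re * φ u =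
      ∫ t : ℝ, ε / (ε ^ 2 + (u + t) ^ 2) * φ u ∂κ := by
    intro u
    have := integral_re (integrable_one_div_add_ofReal_mul_I (κ := κ) (hmem u))
    simp only [RCLike.re_to_complex] at this
    rw [← this, ← integral_mul_const]
    simp_rw [re_one_div_add]
  simp_rw [h1]
  rw [integral_integral_swap]
  · simp_rw [integral_poissonKernel_mul hε]
  · have hi : Integrable (fun p : ℝ × ℝ ↦ ε⁻¹ * ‖φ p.1‖) (volume.prod κ) :=
      ((hφ.norm.integrable_of_hasCompactSupport hc.norm).comp_fst κ).const_mul _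
    refine hi.mono' ?_ (.of_forall fun p ↦ ?_)
    · refine Continuous.aestronglyMeasurable ?_
      refine Continuous.mul (continuous_const.div (by fun_prop) fun p ↦ ?_) (by fun_prop)
      change ε ^ 2 + (p.1 + p.2) ^ 2 ≠ 0
      positivity
    · simp only [Function.uncurry]
      rw [norm_mul]
      gcongr
      rw [Real.norm_of_nonneg (by positivity), div_le_iff₀ (by positivity)]
      have : ε⁻¹ * (ε ^ 2 + (p.1 + p.2) ^ 2) = ε + ε⁻¹ * (p.1 + p.2) ^ 2 := by field_simp
      rw [this]
      have : 0 ≤ ε⁻¹ * (p.1 + p.2) ^ 2 := by positivity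
      linarith

theorem hasNonnegBoundaryRe_of_eq_integral [IsFiniteMeasure κ] {h : ℂ → ℂ}
    (hκ : ∀ s ∈ rightHalfPlane, h s = ∫ t : ℝ, 1 / (s + t * Complex.I) ∂κ) :
    HasNonnegBoundaryRe h := by
  intro φ hφ hc hφ0
  have hφc : Continuous φ := hφ.continuous
  obtain ⟨M, hM⟩ := hc.exists_bound_of_continuous hφc
  have hM' : ∀ ε t x : ℝ, ‖(1 + x ^ 2)⁻¹ * φ (ε * x - t)‖ ≤ (1 + x ^ 2)⁻¹ * M := by
    intro ε t x
    rw [norm_mul, Real.norm_of_nonneg (by positivity)]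
    gcongr
    exact hM _
  have hiM : Integrable fun x : ℝ ↦ (1 + x ^ 2)⁻¹ * M := integrable_inv_one_add_sq.mul_const M
  -- After rescaling by `ε` the Poisson integral makes sense at `ε = 0`; its value there, `π ∫ φ(-t)
  -- dκ(t)`, is the limit.
  refine ⟨∫ t : ℝ, (∫ x : ℝ, (1 + x ^ 2)⁻¹ * φ (0 * x - t)) ∂κ, ?_, ?_⟩
  · exact integral_nonneg fun t ↦ integral_nonneg fun x ↦ mul_nonneg (by positivity) (hφ0 _)
  · have hlim : Tendsto (fun ε : ℝ ↦ ∫ t : ℝ, (∫ x : ℝ, (1 + x ^ 2)⁻¹ * φ (ε * x - t)) ∂κ) (𝓝[>] 0)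
        (𝓝 (∫ t : ℝ, (∫ x : ℝ, (1 + x ^ 2)⁻¹ * φ (0 * x - t)) ∂κ)) := by
      have hcx : ∀ x : ℝ, (1 + x ^ 2) ≠ 0 := fun x ↦ by positivity
      refine tendsto_integral_filter_of_dominated_convergence
        (fun _ ↦ ∫ x : ℝ, (1 + x ^ 2)⁻¹ * M) ?_ ?_ (integrable_const _) ?_
      · refine .of_forall fun ε ↦ ?_
        have : Continuous fun t ↦ ∫ x : ℝ, (1 + x ^ 2)⁻¹ * φ (ε * x - t) := by
          refine continuous_of_dominated (bound := fun x ↦ (1 + x ^ 2)⁻¹ * M) ?_ ?_ hiM ?_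
          · intro t
            exact Continuous.aestronglyMeasurable (by fun_prop (disch := exact hcx))
          · exact fun t ↦ .of_forall fun x ↦ hM' ε t x
          · exact .of_forall fun x ↦ by fun_prop
        exact this.aestronglyMeasurable
      · refine .of_forall fun ε ↦ .of_forall fun t ↦ ?_
        exact norm_integral_le_of_norm_le hiM (.of_forall fun x ↦ hM' ε t x)
      · refine .of_forall fun t ↦ ?_
        refine tendsto_integral_filter_of_dominated_convergence _ ?_
          (.of_forall fun ε ↦ .of_forall fun x ↦ hM' ε t x) hiM ?_
        · exact .of_forall fun ε ↦
            Continuous.aestronglyMeasurable (by fun_prop (disch := exact hcx))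
        · refine .of_forall fun x ↦ ?_
          have : Continuous fun ε : ℝ ↦ (1 + x ^ 2)⁻¹ * φ (ε * x - t) := by fun_prop
          exact (this.tendsto 0).mono_left nhdsWithin_le_nhds
    refine hlim.congr' ?_
    filter_upwards [self_mem_nhdsWithin] with ε hε
    rw [← integral_re_mul_eq hφc hc hε]
    congr 1
    ext u
    rw [hκ]
    simpa [rightHalfPlane] using hε

/-- Functions of the form `∫ s / (s² + t²) dκ(t)`, with a probability measure `κ`, are passive
transfer functions. -/
theorem isPassiveTransfer_of_eq_integral [IsProbabilityMeasure κ] {h : ℂ → ℂ}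
    (hκ : ∀ s ∈ rightHalfPlane, h s = ∫ t : ℝ, s / (s ^ 2 + (t : ℂ) ^ 2) ∂κ) :
    IsPassiveTransfer h := by
  have hκ' : ∀ s ∈ rightHalfPlane,
      h s = ∫ t : ℝ, 1 / (s + t * Complex.I) ∂(symmetrization κ) :=
    fun s hs ↦ (hκ s hs).trans (integral_symmetrization hs).symm
  refine ⟨⟨?_, ?_, hasNonnegBoundaryRe_of_eq_integral hκ'⟩, ⟨⟨1, fun s hs ↦ ?_⟩, ?_⟩⟩
  · exact differentiableOn_integral_one_div_add_ofReal_mul_I.congr hκ'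
  · intro s hs
    rw [hκ s hs, hκ _ (conj_mem_rightHalfPlane hs), ← integral_conj]
    simp
  · rw [hκ' s hs]
    exact norm_integral_one_div_add_ofReal_mul_I_le hs
  · have := tendsto_mul_integral_one_div_add_ofReal_mul_I (symmetrization κ)
    rw [probReal_univ, Complex.ofReal_one] at this
    refine this.congr' ?_
    filter_upwards [eventually_gt_atTop 0] with x hx
    rw [hκ' _ (ofReal_mem_rightHalfPlane hx)]

end CauchyTransform

/-! ### The correspondence with Stieltjes functions -/

/-- The measure of a holomorphic function of nonnegative real part with the symmetry and the
normalization of a transfer function. -/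
theorem exists_measure_of_re_nonneg {h : ℂ → ℂ} (hd : DifferentiableOn ℂ h rightHalfPlane)
    (hconj : ∀ s ∈ rightHalfPlane, h (conj s) = conj (h s))
    (hre : ∀ s ∈ rightHalfPlane, 0 ≤ (h s).re)
    (hn : Tendsto (fun x : ℝ ↦ (x : ℂ) * h (x : ℂ)) atTop (𝓝 1)) :
    ∃ κ : Measure ℝ, IsProbabilityMeasure κ ∧
      (∀ s ∈ rightHalfPlane, h s = ∫ t : ℝ, 1 / (s + t * Complex.I) ∂κ) ∧
      ∀ s ∈ rightHalfPlane, h s = ∫ t : ℝ, s / (s ^ 2 + (t : ℂ) ^ 2) ∂κ := by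
  obtain ⟨κ, hκ, h1⟩ := exists_probabilityMeasure_cauchyTransform hd hre hn
  exact ⟨κ, hκ, h1, fun s hs ↦ eq_integral_div_sq_add_sq hconj h1 hs⟩

theorem IsStieltjes.exists_isPassiveTransfer {f : ℂ → ℂ} (hf : IsStieltjes f) :
    ∃ h : ℂ → ℂ, IsPassiveTransfer h ∧ Corresponds f h ∧
      ∀ h' : ℂ → ℂ, Corresponds f h' → Set.EqOn h' h rightHalfPlane := by
  obtain ⟨μ, hμ, hμ0, hfμ⟩ := hf
  have hm : Measurable fun z : ℝ ↦ √(-z) := by fun_prop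
  have : IsProbabilityMeasure (μ.map fun z : ℝ ↦ √(-z)) :=
    Measure.isProbabilityMeasure_map hm.aemeasurable
  -- The correspondence solved for `h`; the substitution `t = √(-z)` gives its measure.
  refine ⟨fun s ↦ s * f (s ^ 2), ?_, ?_, ?_⟩
  · refine isPassiveTransfer_of_eq_integral (κ := μ.map fun z : ℝ ↦ √(-z)) fun s hs ↦ ?_
    have hcont : Continuous fun t : ℝ ↦ s / (s ^ 2 + (t : ℂ) ^ 2) :=
      continuous_const.div (by fun_prop) (sq_add_sq_ne_zero hs)
    rw [integral_map hm.aemeasurable hcont.aestronglyMeasurable, hfμ _ (sq_mem_slitPlane hs),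
      ← integral_const_mul]
    refine integral_congr_ae ?_
    have hae : ∀ᵐ z ∂μ, z ≤ 0 := by
      rw [ae_iff]
      simpa [Set.Ioi] using hμ0
    filter_upwards [hae] with z hz
    have : ((√(-z) : ℝ) : ℂ) ^ 2 = -z := by
      exact_mod_cast Real.sq_sqrt (neg_nonneg.2 hz)
    rw [this, mul_one_div, ← sub_eq_add_neg]
  · intro z hz
    change f z = z ^ (-(1 / 2) : ℂ) * (z ^ (1 / 2 : ℂ) * f ((z ^ (1 / 2 : ℂ)) ^ 2))
    rw [cpow_half_sq, ← mul_assoc, cpow_neg_half_mul_cpow_half (Complex.slitPlane_ne_zero hz),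
      one_mul]
  · intro h' hh' s hs
    have hz := sq_mem_slitPlane hs
    have h1 := hh' _ hz
    rw [sq_cpow_half hs] at h1
    have h2 := cpow_neg_half_mul_cpow_half (Complex.slitPlane_ne_zero hz)
    rw [sq_cpow_half hs] at h2
    change h' s = s * f (s ^ 2)
    rw [h1]
    linear_combination -(h' s) * h2

theorem IsPassiveTransfer.exists_isStieltjes {h : ℂ → ℂ} (hh : IsPassiveTransfer h) :
    ∃ f : ℂ → ℂ, IsStieltjes f ∧ Corresponds f h ∧
      ∀ f' : ℂ → ℂ, Corresponds f' h → Set.EqOn f' f Complex.slitPlane := by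
  obtain ⟨⟨hd, hconj, hb⟩, ⟨⟨C, hC⟩, hn⟩⟩ := hh
  obtain ⟨κ, hκ, -, hrep⟩ := exists_measure_of_re_nonneg hd hconj
    (fun s hs ↦ re_nonneg_of_hasNonnegBoundaryRe hd hC hb hs) hn
  refine ⟨fun z ↦ z ^ (-(1 / 2) : ℂ) * h (z ^ (1 / 2 : ℂ)), ?_, fun z hz ↦ rfl,
    fun f' hf' z hz ↦ hf' z hz⟩
  have hm : Measurable fun t : ℝ ↦ -t ^ 2 := by fun_prop
  refine ⟨κ.map fun t : ℝ ↦ -t ^ 2, Measure.isProbabilityMeasure_map hm.aemeasurable, ?_, ?_⟩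
  · rw [Measure.map_apply hm measurableSet_Ioi]
    convert measure_empty (μ := κ)
    ext t
    simp only [Set.mem_preimage, Set.mem_Ioi, Set.mem_empty_iff_false, iff_false, not_lt]
    nlinarith [sq_nonneg t]
  · intro z hz
    have hw := cpow_half_mem_rightHalfPlane hz
    have hmz : AEStronglyMeasurable (fun x : ℝ ↦ 1 / (z - (x : ℂ))) (κ.map fun t : ℝ ↦ -t ^ 2) :=
      Measurable.aestronglyMeasurable (by fun_prop)
    change z ^ (-(1 / 2) : ℂ) * h (z ^ (1 / 2 : ℂ)) = _
    rw [hrep _ hw, integral_map hm.aemeasurable hmz, ← integral_const_mul]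
    congr 1
    ext t
    rw [cpow_half_sq, ← mul_div_assoc, cpow_neg_half_mul_cpow_half (Complex.slitPlane_ne_zero hz)]
    push_cast
    rw [sub_neg_eq_add]

/-! ### Solvability and energy estimates for first-order systems -/

section LossySystem

variable {H K : Type*} [NormedAddCommGroup H] [InnerProductSpace ℂ H]
  [NormedAddCommGroup K] [InnerProductSpace ℂ K]

theorem re_inner_smul_self_right (s : ℂ) (x : H) :
    (inner ℂ x (s • x)).re = s.re * ‖x‖ ^ 2 := by
  have h1 : (inner ℂ x x).re = ‖x‖ ^ 2 := inner_self_eq_norm_sq (𝕜 := ℂ) x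
  have h2 : (inner ℂ x x).im = 0 := inner_self_im (𝕜 := ℂ) x
  rw [inner_smul_right, Complex.mul_re, h1, h2, mul_zero, sub_zero]

theorem re_inner_smul_self_left (s : ℂ) (x : H) :
    (inner ℂ (s • x) x).re = s.re * ‖x‖ ^ 2 := by
  rw [← inner_conj_symm, Complex.conj_re, re_inner_smul_self_right]

/-- A coercive bounded operator has a bounded inverse, which is again coercive. -/
theorem ContinuousLinearMap.exists_rightInverse_of_coercive [CompleteSpace H] (T : H →L[ℂ] H)
    {c : ℝ} (hc : 0 < c) (hT : ∀ x, c * ‖x‖ ^ 2 ≤ (inner ℂ (T x) x).re) :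
    ∃ R : H →L[ℂ] H, (∀ x, T (R x) = x) ∧
      ∃ d : ℝ, 0 < d ∧ ∀ x, d * ‖x‖ ^ 2 ≤ (inner ℂ (R x) x).re := by
  have hu : IsUnit T := by
    refine T.isUnit_of_forall_le_norm_inner_map (c := c.toNNReal) (by simpa using hc) fun x ↦ ?_
    rw [Real.coe_toNNReal _ hc.le, mul_comm]
    exact (hT x).trans (Complex.re_le_norm _)
  obtain ⟨U, hU⟩ := hu
  have hR : ∀ x, T ((↑U⁻¹ : H →L[ℂ] H) x) = x := fun x ↦ by
    rw [← hU, ← mul_apply_eq_comp, Units.mul_inv, one_apply_eq_self]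
  refine ⟨(↑U⁻¹ : H →L[ℂ] H), hR, c / (‖T‖ + 1) ^ 2, by positivity, fun x ↦ ?_⟩
  set y := (↑U⁻¹ : H →L[ℂ] H) x with hy
  have h1 : ‖x‖ ≤ (‖T‖ + 1) * ‖y‖ := by
    calc ‖x‖ = ‖T y‖ := by rw [hR]
      _ ≤ ‖T‖ * ‖y‖ := T.le_opNorm y
      _ ≤ (‖T‖ + 1) * ‖y‖ := by gcongr; linarith
  have h2 : (inner ℂ y x).re = (inner ℂ (T y) y).re := by
    rw [hR, ← inner_conj_symm, Complex.conj_re]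
  rw [h2]
  refine le_trans ?_ (hT y)
  rw [div_mul_eq_mul_div, div_le_iff₀ (by positivity), mul_assoc]
  gcongr
  calc ‖x‖ ^ 2 ≤ ((‖T‖ + 1) * ‖y‖) ^ 2 := by gcongr
    _ = ‖y‖ ^ 2 * (‖T‖ + 1) ^ 2 := by ring

variable [CompleteSpace K]

/-- `(u, v)` solves the system with right-hand side `(a, b)` at the frequency `s`. -/
def SolvesSystem (L : K →ₗ.[ℂ] H) (σ : H →L[ℂ] H) (s : ℂ) (u : L.adjoint.domain) (v : L.domain)
    (a : H) (b : K) : Prop :=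
  s • (u : H) + σ u + L v = a ∧ s • (v : K) - L.adjoint u = b

variable {L : K →ₗ.[ℂ] H} {σ : H →L[ℂ] H}

/-- Solvability in the open right half-plane, by the Lax–Milgram argument in the graph space. -/
theorem exists_solvesSystem [CompleteSpace H] (hL : Dense (L.domain : Set K)) (hcl : L.IsClosed)
    (hσ : σ.IsPositive) {s : ℂ} (hs : s ∈ rightHalfPlane) (a : H) :
    ∃ (u : L.adjoint.domain) (v : L.domain), SolvesSystem L σ s u v a 0 := by
  have hs' : 0 < s.re := hs
  have hT : ∀ x, s.re * ‖x‖ ^ 2 ≤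
      (inner ℂ ((s • ContinuousLinearMap.id ℂ H + σ) x) x).re := by
    intro x
    have h1 := hσ.re_inner_nonneg_left x
    rw [add_apply, inner_add_left, Complex.add_re]
    change s.re * ‖x‖ ^ 2 ≤ (inner ℂ (s • x) x).re + _
    rw [re_inner_smul_self_left]
    simpa using h1
  -- With `R = (s + σ)⁻¹` the first equation reads `u = R (a - L v)`. Inserted in the second, it
  -- leaves a variational problem for `v` in the graph of `L`, with form operator `A = s p* p + q* R
  -- q`, coercive in the graph norm.
  obtain ⟨R, hR, d, hd, hRd⟩ := ContinuousLinearMap.exists_rightInverse_of_coercive _ hs' hT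
  let G : Submodule ℂ (WithLp 2 (K × H)) :=
    L.graph.comap (WithLp.prodContinuousLinearEquiv 2 ℂ K H).toLinearEquiv.toLinearMap
  have hG : IsClosed (G : Set (WithLp 2 (K × H))) :=
    IsClosed.preimage (WithLp.prodContinuousLinearEquiv 2 ℂ K H).continuous hcl
  have : CompleteSpace G := hG.completeSpace_coe
  let p : G →L[ℂ] K := WithLp.fstL 2 ℂ K H ∘L G.subtypeL
  let q : G →L[ℂ] H := WithLp.sndL 2 ℂ K H ∘L G.subtypeL
  have hpq : ∀ x : G, ‖x‖ ^ 2 = ‖p x‖ ^ 2 + ‖q x‖ ^ 2 := fun x ↦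
    WithLp.prod_norm_sq_eq_of_L2 (x : WithLp 2 (K × H))
  let A : G →L[ℂ] G := p.adjoint ∘L (s • p) + q.adjoint ∘L R ∘L q
  have hAin : ∀ x y, inner ℂ (A x) y = inner ℂ (s • p x) (p y) + inner ℂ (R (q x)) (q y) := by
    intro x y
    simp only [A, add_apply, smul_apply, ContinuousLinearMap.comp_apply, inner_add_left,
      ContinuousLinearMap.adjoint_inner_left]
  have hA : ∀ x, min s.re d * ‖x‖ ^ 2 ≤ (inner ℂ (A x) x).re := by
    intro x
    rw [hAin, Complex.add_re, re_inner_smul_self_left, hpq, mul_add]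
    refine add_le_add ?_ (le_trans ?_ (hRd (q x)))
    · gcongr; exact min_le_left _ _
    · gcongr; exact min_le_right _ _
  obtain ⟨B, hB, -⟩ :=
    ContinuousLinearMap.exists_rightInverse_of_coercive A (lt_min hs' hd) hA
  set x := B (q.adjoint (R a)) with hx
  have hxA : A x = q.adjoint (R a) := hB _
  have hmem : ∀ y : G, ∃ v : L.domain, (v : K) = p y ∧ L v = q y := by
    intro y
    obtain ⟨v, h1, h2⟩ := (LinearPMap.mem_graph_iff L).1 y.2
    exact ⟨v, h1, h2⟩
  have hmk : ∀ w : L.domain, ∃ y : G, p y = (w : K) ∧ q y = L w := fun w ↦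
    ⟨⟨WithLp.toLp 2 ((w : K), L w), L.mem_graph w⟩, rfl, rfl⟩
  obtain ⟨v, hv1, hv2⟩ := hmem x
  have hw : ∀ w : L.domain, inner ℂ (s • (v : K)) (w : K) = inner ℂ (R (a - L v)) (L w) := by
    intro w
    obtain ⟨y, hy1, hy2⟩ := hmk w
    have h1 := hAin x y
    rw [hxA, ContinuousLinearMap.adjoint_inner_left] at h1
    rw [hv1, hv2, ← hy1, ← hy2, map_sub, inner_sub_left, h1]
    ring
  have hu : R (a - L v) ∈ L.adjoint.domain :=
    LinearPMap.mem_adjoint_domain_of_exists _ ⟨s • (v : K), hw⟩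
  refine ⟨⟨_, hu⟩, v, ?_, ?_⟩
  · have := hR (a - L v)
    simp only [add_apply, smul_apply,
      ContinuousLinearMap.id_apply] at this
    change s • R (a - L v) + σ (R (a - L v)) + L v = a
    rw [this, sub_add_cancel]
  · rw [LinearPMap.adjoint_apply_eq hL ⟨_, hu⟩ hw, sub_self]

/-- The resolvent identity: a change of frequency is absorbed into the data. -/
theorem SolvesSystem.sub {s s' : ℂ} {u u' : L.adjoint.domain} {v v' : L.domain} {a a' : H}
    {b b' : K} (h : SolvesSystem L σ s u v a b) (h' : SolvesSystem L σ s' u' v' a' b') :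
    SolvesSystem L σ s (u - u') (v - v') (a - a' - (s - s') • (u' : H))
      (b - b' - (s - s') • (v' : K)) := by
  obtain ⟨h1, h2⟩ := h
  obtain ⟨h1', h2'⟩ := h'
  constructor
  · rw [← h1, ← h1', LinearPMap.map_sub, Submodule.coe_sub, map_sub]
    module
  · rw [← h2, ← h2', LinearPMap.map_sub, Submodule.coe_sub]
    module

/-- The duality between the solutions at `s` and at `conj s`. -/
theorem SolvesSystem.inner_eq (hL : Dense (L.domain : Set K)) (hσ : σ.IsPositive) {s : ℂ}
    {u u' : L.adjoint.domain} {v v' : L.domain} {a a' : H} {b b' : K}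
    (h : SolvesSystem L σ s u v a b) (h' : SolvesSystem L σ (conj s) u' v' a' b') :
    inner ℂ a' (u : H) - inner ℂ b' (v : K) = inner ℂ (u' : H) a - inner ℂ (v' : K) b := by
  obtain ⟨h1, h2⟩ := h
  obtain ⟨h1', h2'⟩ := h'
  have e1 := LinearPMap.adjoint_isFormalAdjoint hL u' v
  have e2 := (LinearPMap.adjoint_isFormalAdjoint hL).symm v' u
  have e3 := hσ.inner_left_eq_inner_right (u' : H) (u : H)
  rw [← h1, ← h2, ← h1', ← h2']
  simp only [inner_add_left, inner_add_right, inner_sub_left, inner_sub_right, inner_smul_left,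
    inner_smul_right, Complex.conj_conj]
  rw [e1, e2, e3]
  ring

/-- The energy identity, as an inequality. -/
theorem SolvesSystem.energy_le (hL : Dense (L.domain : Set K)) (hσ : σ.IsPositive) {s : ℂ}
    {u : L.adjoint.domain} {v : L.domain} {a : H} {b : K} (h : SolvesSystem L σ s u v a b) :
    s.re * (‖(u : H)‖ ^ 2 + ‖(v : K)‖ ^ 2) ≤
      (inner ℂ (u : H) a).re + (inner ℂ (v : K) b).re := by
  obtain ⟨h1, h2⟩ := h
  have e1 := LinearPMap.adjoint_isFormalAdjoint hL u v
  have e2 : (inner ℂ (v : K) (L.adjoint u)).re = (inner ℂ (u : H) (L v)).re := by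
    rw [← e1, ← inner_conj_symm, Complex.conj_re]
  have e3 : 0 ≤ (inner ℂ (u : H) (σ u)).re := hσ.re_inner_nonneg_right (u : H)
  rw [← h1, ← h2, inner_add_right, inner_add_right, inner_sub_right, Complex.add_re,
    Complex.add_re, Complex.sub_re, e2, re_inner_smul_self_right, re_inner_smul_self_right]
  linarith

theorem SolvesSystem.norm_le (hL : Dense (L.domain : Set K)) (hσ : σ.IsPositive) {s : ℂ}
    (hs : s ∈ rightHalfPlane) {u : L.adjoint.domain} {v : L.domain} {a : H} {b : K}
    (h : SolvesSystem L σ s u v a b) :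
    ‖(u : H)‖ ≤ (‖a‖ + ‖b‖) / s.re ∧ ‖(v : K)‖ ≤ (‖a‖ + ‖b‖) / s.re := by
  have hs' : 0 < s.re := hs
  have h1 := h.energy_le hL hσ
  have h2 : (inner ℂ (u : H) a).re ≤ ‖(u : H)‖ * ‖a‖ :=
    (Complex.re_le_norm _).trans (norm_inner_le_norm _ _)
  have h3 : (inner ℂ (v : K) b).re ≤ ‖(v : K)‖ * ‖b‖ :=
    (Complex.re_le_norm _).trans (norm_inner_le_norm _ _)
  -- Here `x` is the larger of the two norms: the right side is then at most `x (p + q)`, and one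
  -- factor `x` cancels.
  have key : ∀ x y p q : ℝ, 0 ≤ x → 0 ≤ y → 0 ≤ p → 0 ≤ q → y ≤ x →
      s.re * (x ^ 2 + y ^ 2) ≤ x * p + y * q → x ≤ (p + q) / s.re := by
    intro x y p q hx hy hp hq hyx hle
    rw [le_div_iff₀ hs']
    rcases hx.eq_or_lt with rfl | hx'
    · simpa using add_nonneg hp hq
    · refine le_of_mul_le_mul_left ?_ hx'
      nlinarith [mul_le_mul_of_nonneg_right hyx hq, mul_nonneg hs'.le (sq_nonneg y)]
  rcases le_total ‖(v : K)‖ ‖(u : H)‖ with hvu | huv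
  · have := key _ _ _ _ (norm_nonneg _) (norm_nonneg _) (norm_nonneg a) (norm_nonneg b) hvu
      (by linarith)
    exact ⟨this, hvu.trans this⟩
  · have := key _ _ _ _ (norm_nonneg _) (norm_nonneg _) (norm_nonneg b) (norm_nonneg a) huv
      (by linarith)
    rw [add_comm] at this
    exact ⟨huv.trans this, this⟩

/-- If `g` is orthogonal to the domain, solve the lossless system at `s = 1` with data `g`. The
energy `⟨u, g⟩` vanishes, so `u = v = 0` and `g = 0`. -/
theorem dense_adjoint_domain [CompleteSpace H] (hL : Dense (L.domain : Set K))
    (hcl : L.IsClosed) : Dense (L.adjoint.domain : Set H) := by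
  rw [Submodule.dense_iff_topologicalClosure_eq_top, Submodule.topologicalClosure_eq_top_iff,
    Submodule.eq_bot_iff]
  intro g hg
  have h1 : (1 : ℂ) ∈ rightHalfPlane := by simp [rightHalfPlane]
  obtain ⟨u, v, huv⟩ := exists_solvesSystem (σ := 0) hL hcl ContinuousLinearMap.isPositive_zero
    h1 g
  have h2 := huv.energy_le hL ContinuousLinearMap.isPositive_zero
  have h3 : inner ℂ (u : H) g = 0 := (Submodule.mem_orthogonal _ _).1 hg _ u.2
  rw [h3] at h2
  simp only [Complex.one_re, one_mul, Complex.zero_re, inner_zero_right, add_zero] at h2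
  have hu : (u : H) = 0 := by
    rw [← norm_eq_zero]
    nlinarith [sq_nonneg ‖(u : H)‖, sq_nonneg ‖(v : K)‖]
  have hv : (v : K) = 0 := by
    rw [← norm_eq_zero]
    nlinarith [sq_nonneg ‖(u : H)‖, sq_nonneg ‖(v : K)‖]
  have h4 := huv.1
  have hv' : v = 0 := Subtype.ext hv
  rw [hu, hv'] at h4
  simpa using h4.symm

end LossySystem

/-! ### Transfer functions of first-order systems -/

namespace FirstOrderSystem

variable {H K : Type*} [NormedAddCommGroup H] [InnerProductSpace ℂ H]
  [NormedAddCommGroup K] [InnerProductSpace ℂ K] [CompleteSpace K]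

theorem solves_iff (S : FirstOrderSystem H K) (s : ℂ) (u : S.L.adjoint.domain) (v : S.L.domain) :
    S.Solves s u v ↔ SolvesSystem S.L S.loss s u v S.source 0 := Iff.rfl

theorem exists_isTransferFunction [CompleteSpace H] (S : FirstOrderSystem H K) :
    ∃ h : ℂ → ℂ, S.IsTransferFunction h := by
  have hex : ∀ s ∈ rightHalfPlane, ∃ z : ℂ, ∃ (u : S.L.adjoint.domain) (v : S.L.domain),
      S.Solves s u v ∧ z = inner ℂ S.source (u : H) := by
    intro s hs
    obtain ⟨u, v, huv⟩ := exists_solvesSystem S.dense_domain S.closed S.loss_nonneg hs S.source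
    exact ⟨_, u, v, huv, rfl⟩
  choose! h hh using hex
  refine ⟨h, fun s hs ↦ ?_⟩
  obtain ⟨u, v, huv, hz⟩ := hh s hs
  refine ⟨⟨u, v, huv⟩, fun u' v' huv' ↦ ?_⟩
  have h1 := (SolvesSystem.sub ((S.solves_iff _ _ _).1 huv)
    ((S.solves_iff _ _ _).1 huv')).norm_le S.dense_domain S.loss_nonneg hs
  have h2 : (u : H) = u' := by
    rw [← sub_eq_zero, ← norm_le_zero_iff]
    simpa using h1.1
  rw [hz, h2]

variable {S : FirstOrderSystem H K} {h : ℂ → ℂ}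

theorem IsTransferFunction.re_nonneg (hh : S.IsTransferFunction h) {s : ℂ}
    (hs : s ∈ rightHalfPlane) : 0 ≤ (h s).re := by
  obtain ⟨⟨u, v, huv⟩, hu⟩ := hh s hs
  have h1 := ((S.solves_iff _ _ _).1 huv).energy_le S.dense_domain S.loss_nonneg
  have hs' : 0 < s.re := hs
  rw [hu u v huv, ← inner_conj_symm, Complex.conj_re]
  rw [inner_zero_right, Complex.zero_re, add_zero] at h1
  exact le_trans (by positivity) h1

theorem IsTransferFunction.conj_symm (hh : S.IsTransferFunction h) {s : ℂ}
    (hs : s ∈ rightHalfPlane) : h (conj s) = conj (h s) := by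
  obtain ⟨⟨u, v, huv⟩, hu⟩ := hh s hs
  obtain ⟨⟨u', v', huv'⟩, hu'⟩ := hh _ (conj_mem_rightHalfPlane hs)
  have := SolvesSystem.inner_eq S.dense_domain S.loss_nonneg ((S.solves_iff _ _ _).1 huv)
    ((S.solves_iff _ _ _).1 huv')
  simp only [inner_zero_left, inner_zero_right, sub_zero] at this
  rw [hu u v huv, hu' u' v' huv', this, inner_conj_symm]

/-- The resolvent identity paired with the solution at `conj z` writes the difference quotient as
inner products of solutions at `conj z` and at `s`. These converge because solutions depend
continuously on the frequency. -/
theorem IsTransferFunction.differentiableOn (hh : S.IsTransferFunction h) :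
    DifferentiableOn ℂ h rightHalfPlane := by
  have hex : ∀ s : ℂ, ∃ (u : S.L.adjoint.domain) (v : S.L.domain), s ∈ rightHalfPlane →
      S.Solves s u v := fun s ↦ by
    by_cases hs : s ∈ rightHalfPlane
    · obtain ⟨⟨u, v, huv⟩, -⟩ := hh s hs
      exact ⟨u, v, fun _ ↦ huv⟩
    · exact ⟨0, 0, fun h ↦ absurd h hs⟩
  choose U V hUV using hex
  have hcont : ∀ s ∈ rightHalfPlane, Tendsto (fun z ↦ (U z : H)) (𝓝 s) (𝓝 (U s : H)) ∧
      Tendsto (fun z ↦ (V z : K)) (𝓝 s) (𝓝 (V s : K)) := by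
    intro s hs
    have hs' : 0 < s.re := hs
    have hlim : Tendsto (fun z : ℂ ↦ (‖(z - s) • (U s : H)‖ + ‖(z - s) • (V s : K)‖) / z.re)
        (𝓝 s) (𝓝 0) := by
      have : ContinuousAt
          (fun z : ℂ ↦ (‖(z - s) • (U s : H)‖ + ‖(z - s) • (V s : K)‖) / z.re) s := by
        refine ContinuousAt.div ?_ ?_ hs'.ne' <;> fun_prop
      simpa [ContinuousAt] using this
    have hle : ∀ z ∈ rightHalfPlane,
        ‖(U z : H) - U s‖ ≤ (‖(z - s) • (U s : H)‖ + ‖(z - s) • (V s : K)‖) / z.re ∧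
        ‖(V z : K) - V s‖ ≤ (‖(z - s) • (U s : H)‖ + ‖(z - s) • (V s : K)‖) / z.re := by
      intro z hz
      have := (SolvesSystem.sub ((S.solves_iff _ _ _).1 (hUV z hz))
        ((S.solves_iff _ _ _).1 (hUV s hs))).norm_le S.dense_domain S.loss_nonneg hz
      simpa only [sub_self, zero_sub, norm_neg, Submodule.coe_sub] using this
    have hnhds := isOpen_rightHalfPlane.mem_nhds hs
    constructor
    · rw [tendsto_iff_norm_sub_tendsto_zero]
      refine squeeze_zero' (.of_forall fun _ ↦ norm_nonneg _) ?_ hlim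
      filter_upwards [hnhds] with z hz using (hle z hz).1
    · rw [tendsto_iff_norm_sub_tendsto_zero]
      refine squeeze_zero' (.of_forall fun _ ↦ norm_nonneg _) ?_ hlim
      filter_upwards [hnhds] with z hz using (hle z hz).2
  intro s hs
  have hsc := conj_mem_rightHalfPlane hs
  let D : ℂ → ℂ := fun z ↦
    -(inner ℂ (U (conj z) : H) (U s : H) - inner ℂ (V (conj z) : K) (V s : K))
  have hD : Tendsto D (𝓝 s) (𝓝 (D s)) := by
    have hconj : Tendsto (fun z : ℂ ↦ conj z) (𝓝 s) (𝓝 (conj s)) :=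
      Complex.continuous_conj.tendsto s
    exact ((((hcont _ hsc).1.comp hconj).inner tendsto_const_nhds).sub
      (((hcont _ hsc).2.comp hconj).inner tendsto_const_nhds)).neg
  have hder : HasDerivAt h (D s) s := by
    rw [hasDerivAt_iff_tendsto_slope]
    refine (hD.mono_left nhdsWithin_le_nhds).congr' ?_
    filter_upwards [self_mem_nhdsWithin,
      mem_nhdsWithin_of_mem_nhds (isOpen_rightHalfPlane.mem_nhds hs)] with z hzs hz
    have h1 := SolvesSystem.inner_eq S.dense_domain S.loss_nonneg
      (SolvesSystem.sub ((S.solves_iff _ _ _).1 (hUV z hz)) ((S.solves_iff _ _ _).1 (hUV s hs)))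
      ((S.solves_iff _ _ _).1 (hUV _ (conj_mem_rightHalfPlane hz)))
    simp only [sub_self, zero_sub, inner_zero_left, sub_zero, Submodule.coe_sub, inner_sub_right,
      inner_neg_right, inner_smul_right] at h1
    have hzs' : z - s ≠ 0 := sub_ne_zero.2 hzs
    rw [slope_def_field, eq_div_iff hzs', (hh z hz).2 _ _ (hUV z hz), (hh s hs).2 _ _ (hUV s hs),
      h1]
    ring
  exact hder.differentiableAt.differentiableWithinAt

theorem IsTransferFunction.normalized [CompleteSpace H] (hh : S.IsTransferFunction h) :
    Tendsto (fun x : ℝ ↦ (x : ℂ) * h (x : ℂ)) atTop (𝓝 1) := by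
  rw [Metric.tendsto_nhds]
  intro ε hε
  -- `L v` stays bounded but need not be small in norm. Its pairing with `g` is small because `g` is
  -- close to some `g'` in `dom L*`, and `⟨g', L v⟩ = ⟨L* g', v⟩` is `O(1/x)`. The choice `ε / 4`
  -- makes the total tend to `ε / 2`.
  obtain ⟨g', hg', hgg'⟩ := Metric.dense_iff.1 (dense_adjoint_domain S.dense_domain S.closed)
    S.source (ε / 4) (by positivity)
  have hd : ‖S.source - g'‖ < ε / 4 := by
    rw [Metric.mem_ball, dist_eq_norm, ← norm_neg, neg_sub] at hg'
    exact hg'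
  let w : K := S.L.adjoint ⟨g', hgg'⟩
  have hlim : Tendsto (fun x : ℝ ↦ ‖S.loss‖ / x + ε / 4 * (2 + ‖S.loss‖ / x) + ‖w‖ / x) atTop
      (𝓝 (0 + ε / 4 * (2 + 0) + 0)) := by
    have h1 : ∀ c : ℝ, Tendsto (fun x : ℝ ↦ c / x) atTop (𝓝 0) := fun c ↦
      tendsto_const_nhds.div_atTop tendsto_id
    exact ((h1 _).add (((h1 _).const_add _).const_mul _)).add (h1 _)
  have hev := hlim.eventually_lt_const (show 0 + ε / 4 * (2 + 0) + 0 < ε by linarith)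
  filter_upwards [hev, eventually_gt_atTop 0] with x hx hx0
  have hxm := ofReal_mem_rightHalfPlane hx0
  obtain ⟨⟨u, v, huv⟩, hu⟩ := hh _ hxm
  have hn := ((S.solves_iff _ _ _).1 huv).norm_le S.dense_domain S.loss_nonneg hxm
  simp only [S.norm_source, norm_zero, add_zero, Complex.ofReal_re] at hn
  obtain ⟨hnu, hnv⟩ := hn
  have hsum := huv.1
  have hLv : S.L v = S.source - (x : ℂ) • (u : H) - S.loss u := by rw [← hsum]; abel
  have hσu : ‖S.loss (u : H)‖ ≤ ‖S.loss‖ / x := by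
    calc ‖S.loss (u : H)‖ ≤ ‖S.loss‖ * ‖(u : H)‖ := S.loss.le_opNorm _
      _ ≤ ‖S.loss‖ * (1 / x) := by gcongr
      _ = ‖S.loss‖ / x := by ring
  have hnLv : ‖S.L v‖ ≤ 2 + ‖S.loss‖ / x := by
    have h1 : ‖(x : ℂ) • (u : H)‖ ≤ 1 := by
      rw [norm_smul, Complex.norm_real, Real.norm_of_nonneg hx0.le]
      calc x * ‖(u : H)‖ ≤ x * (1 / x) := by gcongr
        _ = 1 := by field_simp
    rw [hLv]
    calc _ ≤ ‖S.source‖ + ‖(x : ℂ) • (u : H)‖ + ‖S.loss u‖ :=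
          (norm_sub_le _ _).trans (by gcongr; exact norm_sub_le _ _)
      _ ≤ 2 + ‖S.loss‖ / x := by rw [S.norm_source]; linarith
  have hkey : (x : ℂ) * h x - 1 = -(inner ℂ S.source (S.loss (u : H)) +
      inner ℂ (S.source - g') (S.L v) + inner ℂ w (v : K)) := by
    have h1 : inner ℂ w (v : K) = inner ℂ g' (S.L v) :=
      LinearPMap.adjoint_isFormalAdjoint S.dense_domain ⟨g', hgg'⟩ v
    have h2 : inner ℂ S.source S.source = (1 : ℂ) := by
      rw [inner_self_eq_norm_sq_to_K, S.norm_source]; simp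
    have h3 : inner ℂ S.source S.source = (x : ℂ) * inner ℂ S.source (u : H) +
        inner ℂ S.source (S.loss (u : H)) + inner ℂ S.source (S.L v) := by
      have h4 := congrArg (inner ℂ S.source) hsum
      rw [inner_add_right, inner_add_right, inner_smul_right] at h4
      exact h4.symm
    rw [hu u v huv, h1, inner_sub_left, ← h2, h3]
    ring
  rw [dist_eq_norm, hkey, norm_neg]
  refine lt_of_le_of_lt ?_ hx
  refine (norm_add₃_le).trans (add_le_add (add_le_add ?_ ?_) ?_)
  · refine (norm_inner_le_norm _ _).trans ?_
    rw [S.norm_source, one_mul]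
    exact hσu
  · exact (norm_inner_le_norm _ _).trans (by gcongr)
  · refine (norm_inner_le_norm _ _).trans ?_
    calc ‖w‖ * ‖(v : K)‖ ≤ ‖w‖ * (1 / x) := by gcongr
      _ = ‖w‖ / x := by ring

end FirstOrderSystem

/-! ### The lossless model: multiplication by `t` on `L²(κ)` -/

section MultiplicationOperator

variable {κ : Measure ℝ}

/-- Multiplication by an essentially bounded function, as a bounded operator on `L²`. -/
noncomputable def mulBounded (m : ℝ → ℂ) (hm : MemLp m ⊤ κ) : Lp ℂ 2 κ →L[ℂ] Lp ℂ 2 κ :=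
  (ContinuousLinearMap.mul ℂ ℂ).holderL κ ⊤ 2 2 (hm.toLp m)

theorem coeFn_mulBounded {m : ℝ → ℂ} (hm : MemLp m ⊤ κ) (f : Lp ℂ 2 κ) :
    mulBounded m hm f =ᵐ[κ] fun t ↦ m t * f t := by
  have h1 := (ContinuousLinearMap.mul ℂ ℂ).coeFn_holder (r := 2) (hm.toLp m) f
  filter_upwards [h1, hm.coeFn_toLp] with t h1 h2
  rw [← h2]
  exact h1

theorem one_add_sq_ne_zero (t : ℝ) : (1 + (t : ℂ) ^ 2) ≠ 0 := by
  have : (1 + t ^ 2 : ℝ) ≠ 0 := by positivity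
  exact_mod_cast this

theorem memLp_top_inv_one_add_sq : MemLp (fun t : ℝ ↦ (1 + (t : ℂ) ^ 2)⁻¹) ⊤ κ := by
  refine memLp_top_of_bound (Continuous.aestronglyMeasurable
    (Continuous.inv₀ (by fun_prop) one_add_sq_ne_zero)) 1 (.of_forall fun t ↦ ?_)
  have h1 : (1 + (t : ℂ) ^ 2) = ((1 + t ^ 2 : ℝ) : ℂ) := by push_cast; ring
  rw [h1, norm_inv, Complex.norm_real, Real.norm_of_nonneg (by positivity)]
  exact inv_le_one_of_one_le₀ (by nlinarith [sq_nonneg t])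

theorem memLp_top_mul_inv_one_add_sq : MemLp (fun t : ℝ ↦ (t : ℂ) * (1 + (t : ℂ) ^ 2)⁻¹) ⊤ κ := by
  refine memLp_top_of_bound (Continuous.aestronglyMeasurable
    (Continuous.mul (by fun_prop) (Continuous.inv₀ (by fun_prop) one_add_sq_ne_zero))) 1
    (.of_forall fun t ↦ ?_)
  have h1 : (1 + (t : ℂ) ^ 2) = ((1 + t ^ 2 : ℝ) : ℂ) := by push_cast; ring
  rw [h1, norm_mul, norm_inv, Complex.norm_real, Complex.norm_real,
    Real.norm_of_nonneg (by positivity : 0 ≤ 1 + t ^ 2), Real.norm_eq_abs,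
    ← div_eq_mul_inv, div_le_one (by positivity)]
  nlinarith [sq_nonneg (|t| - 1), sq_abs t]

variable (κ) in
/-- The operator of multiplication by the independent variable on `L²(κ)`, with its maximal
domain. -/
noncomputable def mulVar : Lp ℂ 2 κ →ₗ.[ℂ] Lp ℂ 2 κ where
  domain :=
    { carrier := {f | MemLp (fun t : ℝ ↦ (t : ℂ) * f t) 2 κ}
      add_mem' := fun {f g} hf hg ↦ by
        refine (hf.add hg).ae_eq ?_
        filter_upwards [Lp.coeFn_add f g] with t ht
        rw [ht, Pi.add_apply, Pi.add_apply, mul_add]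
      zero_mem' := by
        refine (MemLp.zero' (ε := ℂ)).ae_eq ?_
        filter_upwards [Lp.coeFn_zero ℂ 2 κ] with t ht
        rw [ht, Pi.zero_apply, mul_zero]
      smul_mem' := fun c f hf ↦ by
        refine (hf.const_smul c).ae_eq ?_
        filter_upwards [Lp.coeFn_smul c f] with t ht
        rw [ht, Pi.smul_apply, Pi.smul_apply, smul_eq_mul, smul_eq_mul, mul_left_comm] }
  toFun :=
    { toFun := fun f ↦ f.2.toLp _
      map_add' := fun f g ↦ by
        ext1
        filter_upwards [MemLp.coeFn_toLp (f + g).2, MemLp.coeFn_toLp f.2, MemLp.coeFn_toLp g.2,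
          Lp.coeFn_add (f.2.toLp _) (g.2.toLp _), Lp.coeFn_add (f : Lp ℂ 2 κ) g]
          with t h1 h2 h3 h4 h5
        rw [h1, h4, Pi.add_apply, h2, h3, Submodule.coe_add, h5, Pi.add_apply, mul_add]
      map_smul' := fun c f ↦ by
        ext1
        filter_upwards [MemLp.coeFn_toLp (c • f).2, MemLp.coeFn_toLp f.2,
          Lp.coeFn_smul c (f.2.toLp _), Lp.coeFn_smul c (f : Lp ℂ 2 κ)] with t h1 h2 h3 h4
        rw [h1, RingHom.id_apply, h3, Pi.smul_apply, h2, Submodule.coe_smul, h4, Pi.smul_apply,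
          smul_eq_mul, smul_eq_mul, mul_left_comm] }

theorem mem_mulVar_domain {f : Lp ℂ 2 κ} :
    f ∈ (mulVar κ).domain ↔ MemLp (fun t : ℝ ↦ (t : ℂ) * f t) 2 κ := Iff.rfl

theorem coeFn_mulVar (f : (mulVar κ).domain) :
    mulVar κ f =ᵐ[κ] fun t ↦ (t : ℂ) * (f : Lp ℂ 2 κ) t :=
  MemLp.coeFn_toLp f.2

theorem mem_mulVar_graph {f k : Lp ℂ 2 κ} :
    (f, k) ∈ (mulVar κ).graph ↔ k =ᵐ[κ] fun t ↦ (t : ℂ) * f t := by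
  rw [LinearPMap.mem_graph_iff]
  constructor
  · rintro ⟨y, rfl, rfl⟩
    exact coeFn_mulVar y
  · intro h
    have hf : f ∈ (mulVar κ).domain := mem_mulVar_domain.2 ((Lp.memLp k).ae_eq h)
    exact ⟨⟨f, hf⟩, rfl, Lp.ext ((coeFn_mulVar ⟨f, hf⟩).trans h.symm)⟩

/-- Multiplying by `(1 + t²)⁻¹` turns the unbounded relation `k = t f` into an equation between
bounded operators, from which closedness and the action of the adjoint follow. -/
theorem mulBounded_eq_iff {f k : Lp ℂ 2 κ} :
    mulBounded _ memLp_top_mul_inv_one_add_sq f = mulBounded _ memLp_top_inv_one_add_sq k ↔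
      k =ᵐ[κ] fun t ↦ (t : ℂ) * f t := by
  have h1 := coeFn_mulBounded memLp_top_mul_inv_one_add_sq f
  have h2 := coeFn_mulBounded memLp_top_inv_one_add_sq k
  constructor
  · intro h
    rw [h] at h1
    filter_upwards [h1, h2] with t h1 h2
    rw [h2] at h1
    have := one_add_sq_ne_zero t
    field_simp at h1
    exact h1
  · intro h
    ext1
    filter_upwards [h1, h2, h] with t h1 h2 h
    rw [h1, h2, h]
    ring

theorem isClosed_mulVar : (mulVar κ).IsClosed := by
  have : ((mulVar κ).graph : Set (Lp ℂ 2 κ × Lp ℂ 2 κ)) =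
      {p | mulBounded _ memLp_top_mul_inv_one_add_sq p.1 =
        mulBounded _ memLp_top_inv_one_add_sq p.2} := by
    ext ⟨f, k⟩
    exact mem_mulVar_graph.trans mulBounded_eq_iff.symm
  rw [LinearPMap.IsClosed, this]
  exact isClosed_eq (by fun_prop) (by fun_prop)

theorem mulBounded_mem_mulVar_domain (x : Lp ℂ 2 κ) :
    ∃ f : (mulVar κ).domain, (f : Lp ℂ 2 κ) = mulBounded _ memLp_top_inv_one_add_sq x ∧
      mulVar κ f = mulBounded _ memLp_top_mul_inv_one_add_sq x := by
  have h : (mulBounded _ memLp_top_inv_one_add_sq x, mulBounded _ memLp_top_mul_inv_one_add_sq x)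
      ∈ (mulVar κ).graph := by
    rw [mem_mulVar_graph]
    filter_upwards [coeFn_mulBounded memLp_top_inv_one_add_sq x,
      coeFn_mulBounded memLp_top_mul_inv_one_add_sq x] with t h1 h2
    rw [h1, h2]
    ring
  obtain ⟨f, h1, h2⟩ := (LinearPMap.mem_graph_iff _).1 h
  exact ⟨f, h1, h2⟩

theorem inner_mulBounded {m : ℝ → ℂ} (hm : MemLp m ⊤ κ) (hreal : ∀ t, conj (m t) = m t)
    (f g : Lp ℂ 2 κ) : inner ℂ f (mulBounded m hm g) = inner ℂ (mulBounded m hm f) g := by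
  rw [L2.inner_def, L2.inner_def]
  refine integral_congr_ae ?_
  filter_upwards [coeFn_mulBounded hm f, coeFn_mulBounded hm g] with t h1 h2
  rw [h1, h2]
  simp only [RCLike.inner_apply, map_mul, hreal]
  ring

theorem conj_inv_one_add_sq (t : ℝ) : conj ((1 + (t : ℂ) ^ 2)⁻¹) = (1 + (t : ℂ) ^ 2)⁻¹ := by
  simp

theorem conj_mul_inv_one_add_sq (t : ℝ) :
    conj ((t : ℂ) * (1 + (t : ℂ) ^ 2)⁻¹) = (t : ℂ) * (1 + (t : ℂ) ^ 2)⁻¹ := by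
  simp

theorem dense_mulVar_domain : Dense ((mulVar κ).domain : Set (Lp ℂ 2 κ)) := by
  rw [Submodule.dense_iff_topologicalClosure_eq_top, Submodule.topologicalClosure_eq_top_iff,
    Submodule.eq_bot_iff]
  intro g hg
  obtain ⟨f, hf, -⟩ := mulBounded_mem_mulVar_domain
    (mulBounded _ memLp_top_inv_one_add_sq g)
  have h1 : inner ℂ (f : Lp ℂ 2 κ) g = 0 := (Submodule.mem_orthogonal _ _).1 hg _ f.2
  rw [hf, ← inner_mulBounded _ conj_inv_one_add_sq, inner_self_eq_zero] at h1
  have h2 := coeFn_mulBounded memLp_top_inv_one_add_sq g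
  rw [h1] at h2
  rw [Lp.eq_zero_iff_ae_eq_zero]
  filter_upwards [h2, Lp.coeFn_zero ℂ 2 κ] with t h2 h3
  rw [h3] at h2
  simpa [one_add_sq_ne_zero t] using h2.symm

theorem coeFn_adjoint_mulVar (u : (mulVar κ).adjoint.domain) :
    (mulVar κ).adjoint u =ᵐ[κ] fun t ↦ (t : ℂ) * (u : Lp ℂ 2 κ) t := by
  rw [← mulBounded_eq_iff]
  refine ext_inner_right ℂ fun x ↦ ?_
  obtain ⟨f, h1, h2⟩ := mulBounded_mem_mulVar_domain x
  have h3 := LinearPMap.adjoint_isFormalAdjoint dense_mulVar_domain u f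
  rw [h1, h2, inner_mulBounded _ conj_inv_one_add_sq,
    inner_mulBounded _ conj_mul_inv_one_add_sq] at h3
  exact h3.symm

variable (κ) in
/-- The lossless system given by the multiplication operator on `L²(κ)` and the source `1`. -/
noncomputable def multiplicationSystem [IsProbabilityMeasure κ] :
    FirstOrderSystem (Lp ℂ 2 κ) (Lp ℂ 2 κ) where
  L := mulVar κ
  dense_domain := dense_mulVar_domain
  closed := isClosed_mulVar
  loss := 0
  loss_nonneg := ContinuousLinearMap.isPositive_zero
  source := (memLp_const (1 : ℂ)).toLp _
  norm_source := by
    rw [Lp.norm_toLp, eLpNorm_const _ two_ne_zero (IsProbabilityMeasure.ne_zero κ)]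
    simp

/-- The system decouples pointwise into `s u + t v = 1` and `s v = t u`, whence `u = s / (s² + t²)`.
-/
theorem isTransferFunction_multiplicationSystem [IsProbabilityMeasure κ] {h : ℂ → ℂ}
    (hκ : ∀ s ∈ rightHalfPlane, h s = ∫ t : ℝ, s / (s ^ 2 + (t : ℂ) ^ 2) ∂κ) :
    (multiplicationSystem κ).IsTransferFunction h := by
  intro s hs
  refine ⟨exists_solvesSystem dense_mulVar_domain isClosed_mulVar
    ContinuousLinearMap.isPositive_zero hs _, fun u v huv ↦ ?_⟩
  rw [hκ s hs, L2.inner_def]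
  refine integral_congr_ae ?_
  have hsource := (memLp_const (μ := κ) (p := 2) (1 : ℂ)).coeFn_toLp
  have h1 : (s • (u : Lp ℂ 2 κ) + mulVar κ v) = (memLp_const (1 : ℂ)).toLp _ := by
    have h1 : s • (u : Lp ℂ 2 κ) + (0 : Lp ℂ 2 κ) + mulVar κ v = _ := huv.1
    rwa [add_zero] at h1
  have h2 : s • (v : Lp ℂ 2 κ) = (mulVar κ).adjoint u := sub_eq_zero.1 huv.2
  have e1 := Lp.coeFn_add (s • (u : Lp ℂ 2 κ)) (mulVar κ v)
  have e2 := Lp.coeFn_smul s (v : Lp ℂ 2 κ)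
  rw [h1] at e1
  rw [h2] at e2
  filter_upwards [hsource, e1, e2, Lp.coeFn_smul s (u : Lp ℂ 2 κ), coeFn_mulVar v,
    coeFn_adjoint_mulVar u] with t h1 h2 h3 h4 h5 h6
  have h7 : (multiplicationSystem κ).source t = 1 := h1
  rw [h1, Pi.add_apply, h4, h5, Pi.smul_apply, smul_eq_mul] at h2
  rw [h6, Pi.smul_apply, smul_eq_mul] at h3
  rw [h7, RCLike.inner_apply, map_one, mul_one, div_eq_iff (sq_add_sq_ne_zero hs t)]
  linear_combination s * h2 - (t : ℂ) * h3

/-- An eigenvector satisfies `(t² - c) u = 0` almost everywhere, and `t² = c` holds for at most two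
real `t`, a null set without atoms. -/
theorem noPointSpectrum_multiplicationSystem [IsProbabilityMeasure κ] [NullSingletonClass κ] :
    (multiplicationSystem κ).NoPointSpectrum := by
  intro c u v hv hc
  have hnull : κ {t : ℝ | (t : ℂ) ^ 2 = c} = 0 := by
    by_cases hex : ∃ a : ℝ, (a : ℂ) ^ 2 = c
    · obtain ⟨a, ha⟩ := hex
      refine Set.Finite.measure_zero (Set.Finite.subset (Set.toFinite {a, -a}) fun t ht ↦ ?_) κ
      have : t ^ 2 = a ^ 2 := by
        have h1 : (t : ℂ) ^ 2 = (a : ℂ) ^ 2 := by rw [ha]; exact ht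
        exact_mod_cast h1
      exact sq_eq_sq_iff_eq_or_eq_neg.1 this
    · convert measure_empty (μ := κ)
      ext t
      simp only [Set.mem_ofPred_eq, Set.mem_empty_iff_false, iff_false]
      exact fun ht ↦ hex ⟨t, ht⟩
  have hae : ∀ᵐ t : ℝ ∂κ, (t : ℂ) ^ 2 ≠ c := by
    rw [ae_iff]
    simpa using hnull
  have h1 : mulVar κ v = c • (u : Lp ℂ 2 κ) := hc
  have h2 : (v : Lp ℂ 2 κ) = (mulVar κ).adjoint u := hv
  have e1 := coeFn_mulVar v
  have e2 := coeFn_adjoint_mulVar u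
  rw [h1] at e1
  rw [← h2] at e2
  rw [Lp.eq_zero_iff_ae_eq_zero]
  filter_upwards [hae, e1, e2, Lp.coeFn_smul c (u : Lp ℂ 2 κ)] with t ht e1 e2 e3
  rw [e1, e2, Pi.smul_apply, smul_eq_mul] at e3
  have : ((t : ℂ) ^ 2 - c) * (u : Lp ℂ 2 κ) t = 0 := by linear_combination e3
  exact (mul_eq_zero.1 this).resolve_left (sub_ne_zero.2 ht)

/-- At `s = ε - ia` the Poisson kernel equals `1/ε` at `t = a`, so an atom at `a` would make `Re h`
blow up like its mass over `ε`. -/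
theorem nullSingletonClass_of_bounded [IsFiniteMeasure κ] {h : ℂ → ℂ} {M : ℝ}
    (hκ : ∀ s ∈ rightHalfPlane, h s = ∫ t : ℝ, 1 / (s + t * Complex.I) ∂κ)
    (hM : ∀ s ∈ rightHalfPlane, ‖h s‖ ≤ M) : NullSingletonClass κ := by
  constructor
  intro a
  have hle : ∀ ε : ℝ, 0 < ε → κ.real {a} ≤ ε * M := by
    intro ε hε
    have hs : (ε : ℂ) + Complex.I * ((-a : ℝ) : ℂ) ∈ rightHalfPlane := by
      simpa [rightHalfPlane] using hε
    have hi := integrable_one_div_add_ofReal_mul_I (κ := κ) hs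
    have h1 := integral_re hi
    simp only [RCLike.re_to_complex] at h1
    rw [← hκ _ hs] at h1
    have h2 : Integrable (fun t : ℝ ↦ ε / (ε ^ 2 + (-a + t) ^ 2)) κ :=
      hi.re.congr (.of_forall fun t ↦ re_one_div_add _ _ _)
    have h3 := setIntegral_le_integral (s := {a}) h2 (.of_forall fun t ↦ by
      change 0 ≤ ε / (ε ^ 2 + (-a + t) ^ 2)
      positivity)
    rw [integral_singleton] at h3
    simp_rw [re_one_div_add] at h1
    rw [h1] at h3
    have h4 := (Complex.re_le_norm _).trans (hM _ hs)
    have h5 : κ.real {a} * ε⁻¹ ≤ M := by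
      refine le_trans (le_of_eq ?_) (h3.trans h4)
      rw [smul_eq_mul]
      congr 1
      field_simp
      ring
    rw [← div_eq_mul_inv, div_le_iff₀ hε] at h5
    linarith
  have hlim : Tendsto (fun ε : ℝ ↦ ε * M) (𝓝[>] 0) (𝓝 0) := by
    have : Continuous fun ε : ℝ ↦ ε * M := by fun_prop
    exact (this.tendsto' 0 0 (by simp)).mono_left nhdsWithin_le_nhds
  have h0 : κ.real {a} ≤ 0 :=
    ge_of_tendsto hlim (by filter_upwards [self_mem_nhdsWithin] with ε hε using hle ε hε)
  have h1 : κ.real {a} = 0 := le_antisymm h0 measureReal_nonneg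
  exact (measureReal_eq_zero_iff).1 h1

theorem HasPoleResidueForm.bounded {h : ℂ → ℂ} (hh : HasPoleResidueForm h) :
    ∃ M : ℝ, ∀ s ∈ rightHalfPlane, ‖h s‖ ≤ M := by
  obtain ⟨n, y, p, hp, hrep⟩ := hh
  have hle : ∀ s ∈ rightHalfPlane, ∀ q : ℂ, ∀ r : ℝ, 0 < r → q.re = r → ∀ c : ℂ,
      ‖c / (s + q)‖ ≤ ‖c‖ / r := by
    intro s hs q r hr hq c
    have hs' : 0 < s.re := hs
    rw [norm_div]
    refine div_le_div_of_nonneg_left (norm_nonneg c) hr (le_trans ?_ (Complex.re_le_norm _))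
    rw [Complex.add_re, hq]
    linarith
  refine ⟨∑ j, (‖y j‖ / (p j).re + ‖conj (y j)‖ / (p j).re), fun s hs ↦ ?_⟩
  rw [hrep s hs]
  refine (norm_sum_le _ _).trans (Finset.sum_le_sum fun j _ ↦ (norm_add_le _ _).trans ?_)
  exact add_le_add (hle s hs _ _ (hp j) rfl _) (hle s hs _ _ (hp j) (Complex.conj_re _) _)

end MultiplicationOperator

/-! ### Assembly -/

theorem proposition2 :
    -- every Stieltjes function is transformed to a unique passive transfer function
    (∀ f : ℂ → ℂ, IsStieltjes f →
      ∃ h : ℂ → ℂ, IsPassiveTransfer h ∧ Corresponds f h ∧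
        ∀ h' : ℂ → ℂ, Corresponds f h' → Set.EqOn h' h rightHalfPlane) ∧
    -- and vice versa
    (∀ h : ℂ → ℂ, IsPassiveTransfer h →
      ∃ f : ℂ → ℂ, IsStieltjes f ∧ Corresponds f h ∧
        ∀ f' : ℂ → ℂ, Corresponds f' h → Set.EqOn f' f Complex.slitPlane) ∧
    -- every first-order system, lossy or lossless, has a passive transfer function, which
    -- is also the transfer function of a lossless system; the lossless system can be taken
    -- without point spectrum if the transfer function is in pole-residue form
    (∀ (H K : Type*) [NormedAddCommGroup H] [InnerProductSpace ℂ H] [CompleteSpace H]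
      [NormedAddCommGroup K] [InnerProductSpace ℂ K] [CompleteSpace K]
      (S : FirstOrderSystem H K),
      ∃ h : ℂ → ℂ, S.IsTransferFunction h ∧ IsPassiveTransfer h ∧
        ∃ (H' K' : Type) (_ : NormedAddCommGroup H') (_ : InnerProductSpace ℂ H')
          (_ : CompleteSpace H') (_ : NormedAddCommGroup K') (_ : InnerProductSpace ℂ K')
          (_ : CompleteSpace K') (S' : FirstOrderSystem H' K'),
          S'.IsLossless ∧ S'.IsTransferFunction h ∧
            (HasPoleResidueForm h → S'.NoPointSpectrum)) := by
  refine ⟨fun f hf ↦ hf.exists_isPassiveTransfer, fun h hh ↦ hh.exists_isStieltjes, ?_⟩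
  intro H K _ _ _ _ _ _ S
  obtain ⟨h, hh⟩ := S.exists_isTransferFunction
  obtain ⟨κ, hκ, hc, hsq⟩ := exists_measure_of_re_nonneg hh.differentiableOn
    (fun s hs ↦ hh.conj_symm hs) (fun s hs ↦ hh.re_nonneg hs) hh.normalized
  refine ⟨h, hh, isPassiveTransfer_of_eq_integral hsq, Lp ℂ 2 κ, Lp ℂ 2 κ, inferInstance,
    inferInstance, inferInstance, inferInstance, inferInstance, inferInstance,
    multiplicationSystem κ, rfl, isTransferFunction_multiplicationSystem hsq, fun hp ↦ ?_⟩
  obtain ⟨M, hM⟩ := hp.bounded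
  have := nullSingletonClass_of_bounded hc hM
  exact noPointSpectrum_multiplicationSystem
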